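/- Let $s\ge 1$, $I=\{1,\dots,s+1\}$, and let $(f_i)_{i\in I}$ be a family of $C^{1+\epsilon}$ diffeomorphisms of $\mathbb R$, i.e. $C^1$ diffeomorphisms whose derivatives are $\epsilon$-Hölder continuous for some $\epsilon>0$. Let $\overline{\mathbb R}=\mathbb R\cup\{\pm\infty\}$ be the two-point compactification, endowed with a compatible metric $d$ which is strongly equivalent to the Euclidean metric on compact subsets of $\mathbb R$, and put $f_i(\pm\infty)=\pm\infty$. Assume that - $(f_i)$ is expanding: there is $\lambda>1$ with $f_i'(x)\ge\lambda$ for all $x\in\mathbb R$, $i\in I$; - there is no $x\in\mathbb R$ with $f_i(x)=x$ for all $i\in I$; - $(f_i)$ is contracting near infinity: there are neighbourhoods of $+\infty$ and of $-\infty$ in $\overline{\mathbb R}$ on each of which every $f_i$ has Lipschitz constant $<1$ with respect to $d$; - the separating condition holds: there is a non-empty bounded open interval $O\subset\mathbb R$ with $f_i^{-1}(O)\subset O$ for all $i\in I$ and $f_i^{-1}(\overline O)\cap f_j^{-1}(\overline O)=\emptyset$ for all $i\ne j$. Let $\Sigma=I^{\mathbb N}$ with left shift $\sigma$, and write $f_{\omega|n}=f_{\omega_n}\circ\dots\circ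 f_{\omega_1}$ for $\omega\in\Sigma$. Let $V=V^+\cup V^-$, where $V^{\pm}\subset\overline{\mathbb R}$ are neighbourhoods of $\pm\infty$ such that $f_{\omega|n}(x)\to\pm\infty$ as $n\to\infty$ for all $x\in V^{\pm}$ and all $\omega\in\Sigma$. Let $\vec p=(p_1,\dots,p_s)\in(0,1)^s$ with $\sum_{i=1}^s p_i<1$, and put $p_{s+1}=1-\sum_{i=1}^s p_i$. For such a parameter $\vec u$ let $\mu_{\vec u}$ be the Bernoulli measure on $\Sigma$ with weights $(u_1,\dots,u_s,1-\sum_{i=1}^s u_i)$, and let $T_{\vec u}(x)=\mu_{\vec u}\{\omega\in\Sigma : f_{\omega|n}(x)\to+\infty\}$ for $x\in\overline{\mathbb R}$. For $\vec n\in\mathbb N_0^s$ put $$C_{\vec n}(x)=\frac{\partial^{\,n_1+\dots+n_s}}{\partial u_1^{n_1}\cdots\partial u_s^{n_s}}T_{\vec u}(x)\Big|_{\vec u=\vec p},$$ and let $\mathcal T$ be the real vector space spanned by the functions $C_{\vec n}$. An element $C\in\mathcal T$ is called non-trivial if $C=\sum_{\vec n}\beta_{\vec n}C_{\vec n}$ for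 some finitely supported real family $(\beta_{\vec n})\ne 0$. For $x\in\mathbb R$ define $$\mathrm{Hol}(C,x)=\sup\Big\{\alpha>0 : \limsup_{y\to x}\frac{|C(y)-C(x)|}{|y-x|^\alpha}<\infty\Big\}\in[0,\infty].$$ Let $C\in\mathcal T$ be non-trivial. Then for every $\omega\in\Sigma$ the set $\bigcap_{n\ge1}f_{\omega|n}^{-1}(\overline{\mathbb R}\setminus V)$ consists of a single point $\pi(\omega)\in\mathbb R$, and for $x=\pi(\omega)$ $$\mathrm{Hol}(C,x)=\liminf_{n\to\infty}\frac{S_n\psi(\omega)}{S_n\varphi(\omega)},$$ where $\psi(\omega)=\log p_{\omega_1}$, $\varphi(\omega)=-\log|f_{\omega_1}'(\pi(\omega))|$ and $S_nu=\sum_{k=0}^{n-1}u\circ\sigma^k$. -/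

import Mathlib

open Filter Topology MeasureTheory Set
open scoped ENNReal NNReal

noncomputable section

namespace GenTakagi

/-! The index set `{1, …, s+1}` is `Fin (s + 1)`; a sequence `ω ∈ Σ` is a function
`ω : ℕ → Fin (s + 1)`, so that `ω 0` is the first symbol. The two-point compactification of the
real line is `EReal`. -/

/-- Each `f i` is a `C¹` diffeomorphism of the line, and for some `ε > 0` all the derivatives are
`ε`-Hölder continuous. -/
def IsDiffeoFamily {s : ℕ} (f : Fin (s + 1) → ℝ → ℝ) : Prop :=
  (∀ i, ContDiff ℝ 1 (f i) ∧
    ∃ g : ℝ → ℝ, ContDiff ℝ 1 g ∧ Function.LeftInverse g (f i) ∧ Function.RightInverse g (f i)) ∧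
  ∃ ε : ℝ≥0, 0 < ε ∧ ∀ i, ∃ K : ℝ≥0, HolderWith K ε (deriv (f i))

/-- The derivatives are bounded below by a common constant larger than one. -/
def IsExpanding {s : ℕ} (f : Fin (s + 1) → ℝ → ℝ) : Prop :=
  ∃ l : ℝ, 1 < l ∧ ∀ i x, l ≤ deriv (f i) x

def NoCommonFixedPoint {s : ℕ} (f : Fin (s + 1) → ℝ → ℝ) : Prop :=
  ¬ ∃ x : ℝ, ∀ i, f i x = x

/-- `d` is a metric on the two-point compactification which induces its topology and is strongly
equivalent to the Euclidean metric on compact subsets of the line. -/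
structure IsAdmissibleMetric (d : EReal → EReal → ℝ) : Prop where
  eq_zero_iff : ∀ x y, d x y = 0 ↔ x = y
  symm : ∀ x y, d x y = d y x
  triangle : ∀ x y z, d x z ≤ d x y + d y z
  nhds_basis : ∀ x, (𝓝 x).HasBasis (fun r : ℝ => 0 < r) (fun r => {y | d x y < r})
  equiv_on_compact : ∀ K : Set ℝ, IsCompact K → ∃ c : ℝ, 0 < c ∧ ∀ x ∈ K, ∀ y ∈ K,
    c⁻¹ * |x - y| ≤ d (x : EReal) (y : EReal) ∧ d (x : EReal) (y : EReal) ≤ c * |x - y|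

/-- The extension of a self-map of the line by `±∞ ↦ ±∞`. -/
def extend (g : ℝ → ℝ) : EReal → EReal :=
  EReal.rec ⊥ (fun x => ((g x : ℝ) : EReal)) ⊤

/-- There are neighbourhoods of `±∞` on each of which every `f i` has Lipschitz constant less
than one for `d`. -/
def ContractingNearInfinity {s : ℕ} (d : EReal → EReal → ℝ) (f : Fin (s + 1) → ℝ → ℝ) : Prop :=
  ∃ Vp ∈ 𝓝 (⊤ : EReal), ∃ Vm ∈ 𝓝 (⊥ : EReal), ∀ i, ∃ c : ℝ, c < 1 ∧
    (∀ x ∈ Vp, ∀ y ∈ Vp, d (extend (f i) x) (extend (f i) y) ≤ c * d x y) ∧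
    (∀ x ∈ Vm, ∀ y ∈ Vm, d (extend (f i) x) (extend (f i) y) ≤ c * d x y)

def SeparatingCondition {s : ℕ} (f : Fin (s + 1) → ℝ → ℝ) : Prop :=
  ∃ a b : ℝ, a < b ∧ (∀ i, f i ⁻¹' Ioo a b ⊆ Ioo a b) ∧
    ∀ i j, i ≠ j → Disjoint (f i ⁻¹' closure (Ioo a b)) (f j ⁻¹' closure (Ioo a b))

/-- The random orbit map `f_{ω|n} = f_{ω_n} ∘ ⋯ ∘ f_{ω_1}` on the compactification. -/
def orbitMap {s : ℕ} (f : Fin (s + 1) → ℝ → ℝ) (ω : ℕ → Fin (s + 1)) : ℕ → EReal → EReal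
  | 0 => id
  | n + 1 => extend (f (ω n)) ∘ orbitMap f ω n

/-- `Vp`, `Vm` are neighbourhoods of `+∞`, `-∞` whose points tend to `+∞`, respectively `-∞`,
along every sequence of maps. -/
structure IsEscapePair {s : ℕ} (f : Fin (s + 1) → ℝ → ℝ) (Vp Vm : Set EReal) : Prop where
  top_mem : Vp ∈ 𝓝 (⊤ : EReal)
  bot_mem : Vm ∈ 𝓝 (⊥ : EReal)
  tendsto_top : ∀ x ∈ Vp, ∀ ω : ℕ → Fin (s + 1),
    Tendsto (fun n => orbitMap f ω n x) atTop (𝓝 ⊤)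
  tendsto_bot : ∀ x ∈ Vm, ∀ ω : ℕ → Fin (s + 1),
    Tendsto (fun n => orbitMap f ω n x) atTop (𝓝 ⊥)

/-- The set `J_ω` of points whose orbit along `ω` never enters `V` (at the times `n ≥ 1`). -/
def fiber {s : ℕ} (f : Fin (s + 1) → ℝ → ℝ) (V : Set EReal) (ω : ℕ → Fin (s + 1)) : Set EReal :=
  ⋂ n : ℕ, orbitMap f ω (n + 1) ⁻¹' Vᶜ

/-- The coding map: `π(ω)` is the real number with `J_ω = {π(ω)}`. -/
def codingMap {s : ℕ} (f : Fin (s + 1) → ℝ → ℝ) (V : Set EReal) (ω : ℕ → Fin (s + 1)) : ℝ :=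
  Classical.epsilon fun x : ℝ => fiber f V ω = {(x : EReal)}

/-- The open set of admissible probability parameters `(p_1, …, p_s)`. -/
def paramSet (s : ℕ) : Set (Fin s → ℝ) :=
  {p | (∀ i, p i ∈ Ioo (0 : ℝ) 1) ∧ ∑ i, p i < 1}

/-- The full vector `(p_1, …, p_s, p_{s+1})` with `p_{s+1} = 1 - ∑ p_i`. -/
def probVec {s : ℕ} (p : Fin s → ℝ) : Fin (s + 1) → ℝ :=
  Fin.snoc (α := fun _ => ℝ) p (1 - ∑ i, p i)

theorem probVec_pos {s : ℕ} {p : Fin s → ℝ} (hp : p ∈ paramSet s) (i : Fin (s + 1)) :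
    0 < probVec p i := by
  induction i using Fin.lastCases with
  | last => simpa [probVec] using hp.2
  | cast i => simpa [probVec] using (hp.1 i).1

theorem sum_probVec {s : ℕ} (p : Fin s → ℝ) : ∑ i, probVec p i = 1 := by
  simp [Fin.sum_univ_castSucc, probVec]

/-- The law of one symbol. -/
def symbolLaw {s : ℕ} (p : Fin s → ℝ) (hp : p ∈ paramSet s) : PMF (Fin (s + 1)) :=
  PMF.ofFintype (fun i => ENNReal.ofReal (probVec p i)) (by
    rw [← ENNReal.ofReal_sum_of_nonneg (fun i _ => (probVec_pos hp i).le), sum_probVec,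
      ENNReal.ofReal_one])

/-- The Bernoulli measure on the space of sequences. -/
def bernoulli {s : ℕ} (p : Fin s → ℝ) (hp : p ∈ paramSet s) : Measure (ℕ → Fin (s + 1)) :=
  Measure.infinitePi fun _ => (symbolLaw p hp).toMeasure

open Classical in
/-- The probability `T_p(x)` of tending to `+∞` when starting at `x` (extended by zero to
parameters outside the open set `paramSet s`). -/
def probInfty {s : ℕ} (f : Fin (s + 1) → ℝ → ℝ) (p : Fin s → ℝ) (x : EReal) : ℝ :=
  if hp : p ∈ paramSet s then
    (bernoulli p hp).real {ω | Tendsto (fun n => orbitMap f ω n x) atTop (𝓝 ⊤)}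
  else 0

/-- The partial derivative in the `i`-th coordinate. -/
def partialDeriv {s : ℕ} (i : Fin s) (F : (Fin s → ℝ) → ℝ) : (Fin s → ℝ) → ℝ :=
  fun u => lineDeriv ℝ F u (Pi.single i 1)

/-- The operator `∂^{n_1 + ⋯ + n_s} / ∂u_1^{n_1} ⋯ ∂u_s^{n_s}`. -/
def iteratedPartial {s : ℕ} (n : Fin s → ℕ) (F : (Fin s → ℝ) → ℝ) : (Fin s → ℝ) → ℝ :=
  (List.finRange s).foldr (fun i G => (partialDeriv i)^[n i] G) F

/-- The function `C_n`, the `n`-th parameter derivative of `T` at `p`. -/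
def takagiFun {s : ℕ} (f : Fin (s + 1) → ℝ → ℝ) (p : Fin s → ℝ) (n : Fin s → ℕ) : EReal → ℝ :=
  fun x => iteratedPartial n (fun u => probInfty f u x) p

/-- The real vector space of generalised Takagi functions. -/
def takagiSpace {s : ℕ} (f : Fin (s + 1) → ℝ → ℝ) (p : Fin s → ℝ) : Submodule ℝ (EReal → ℝ) :=
  Submodule.span ℝ (range (takagiFun f p))

/-- `C = ∑ β_n C_n` for some non-zero finitely supported family `β`. -/
def IsNontrivial {s : ℕ} (f : Fin (s + 1) → ℝ → ℝ) (p : Fin s → ℝ) (C : EReal → ℝ) : Prop :=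
  ∃ β : (Fin s → ℕ) →₀ ℝ, β ≠ 0 ∧ C = β.sum fun n b => b • takagiFun f p n

/-- The pointwise Hölder exponent, in `[0, ∞]`. -/
def holderExponent (C : EReal → ℝ) (x : ℝ) : ℝ≥0∞ :=
  ⨆ (α : ℝ) (_ : 0 < α) (_ : limsup (fun y : ℝ =>
      ENNReal.ofReal (|C (y : EReal) - C (x : EReal)| / |y - x| ^ α)) (𝓝[≠] x) < ⊤),
    ENNReal.ofReal α

/-- The left shift on sequences. -/
def shift {s : ℕ} (ω : ℕ → Fin (s + 1)) : ℕ → Fin (s + 1) := fun n => ω (n + 1)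

/-- The geometric potential `φ(ω) = -log |f_{ω_1}'(π(ω))|`. -/
def phi {s : ℕ} (f : Fin (s + 1) → ℝ → ℝ) (V : Set EReal) (ω : ℕ → Fin (s + 1)) : ℝ :=
  -Real.log |deriv (f (ω 0)) (codingMap f V ω)|

/-- The potential `ψ(ω) = log p_{ω_1}`. -/
def psi {s : ℕ} (p : Fin s → ℝ) (ω : ℕ → Fin (s + 1)) : ℝ :=
  Real.log (probVec p (ω 0))

end GenTakagi

end

/-!
Write `u_{ω|n}` for the product of the weights of the first `n` symbols of `ω`, and `[a, b]` for the
closure of the separating interval. Expansion lets one enlarge `[a, b]` to `[a - η, b + η]` without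
losing disjointness of the first-level preimages (`IsSeparatedSystem`). The orbit of `x = π(ω)`
along `ω` stays in `[a, b]`, while every other point escapes, which gives the statement about the
fibre.

*Self-similarity.* By shift invariance `T_u(x) = ∑ u_i T_u(f_i x)`, and since the cylinders are
disjoint, two points `x`, `y` of the level-`n` cylinder of `ω` satisfy
`T_u(y) - T_u(x) = u_{ω|n} (T_u(f_{ω|n} y) - T_u(f_{ω|n} x))` (`probInfty_sub_eq_prod_mul`).

*Smoothness.* On the Banach space of bounded functions, the functional equation is an affine
equation whose linear part is a strict contraction depending affinely on `u`. Inverting it shows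
that `u ↦ T_u` is smooth with values in bounded functions (`contDiffOn_escapeFun`), so the parameter
derivatives of `T_u(x)` exist and are bounded uniformly in `x`.

*Upper bound.* A function `C = ∑ β_k C_k` is the differential operator `∑ β_k ∂^k` at `p` applied to
`T_u`. By the Leibniz rule and the self-similarity, an increment of `C` within a cylinder of
level `n` is at most a polynomial in `n` times `p_{ω|n}` (`exists_abs_increment_le`).

*Lower bound.* Increments of `T_u` within the cylinder realise `u_{ω|n}` times any word in the
weights, hence, after finite linear combination, `u_{ω|n}` times any polynomial. For `k` maximal in
the support of `β`, the operator maps `u_{ω|n} (u - p)^k` to exactly `β_k k! p_{ω|n}`. So in each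
cylinder some increment of `C` is at least a constant times `p_{ω|n}` (`exists_increment_ge`).

*Geometry.* By bounded distortion, a level-`n` cylinder has size comparable to
`exp (S_n φ(ω))`, and a point `y` that leaves the enlarged interval at time `n + 1` is at least that
far from `x`, up to a constant, because the orbit of `x` keeps the distance `η` from the boundary
(`exists_distortion`, `exists_exit_time`). Comparing `p_{ω|n} = exp (S_n ψ(ω))` with
`exp (S_n φ(ω))` yields the Hölder exponent (`holderExponent_eq_liminf`); polynomial factors are
irrelevant as `exp (S_n φ(ω))` decays exponentially.
-/

noncomputable section

namespace GenTakagi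

/-! ### Iterated partial derivatives on open sets -/

section PartialDeriv

open scoped ContDiff

variable {s : ℕ} {U : Set (Fin s → ℝ)}

theorem partialDeriv_eq_fderiv (hU : IsOpen U) {F : (Fin s → ℝ) → ℝ} (hF : ContDiffOn ℝ ∞ F U)
    (i : Fin s) {u : Fin s → ℝ} (hu : u ∈ U) :
    partialDeriv i F u = fderiv ℝ F u (Pi.single i 1) :=
  ((hF.contDiffAt (hU.mem_nhds hu)).differentiableAt (by simp)).lineDeriv_eq_fderiv

theorem contDiffOn_partialDeriv (hU : IsOpen U) {F : (Fin s → ℝ) → ℝ} (hF : ContDiffOn ℝ ∞ F U)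
    (i : Fin s) : ContDiffOn ℝ ∞ (partialDeriv i F) U :=
  ((hF.fderiv_of_isOpen hU (m := ∞) (by simp)).clm_apply contDiffOn_const).congr
    fun _ hu => partialDeriv_eq_fderiv hU hF i hu

theorem partialDeriv_congr (hU : IsOpen U) {F G : (Fin s → ℝ) → ℝ} (h : EqOn F G U) (i : Fin s) :
    EqOn (partialDeriv i F) (partialDeriv i G) U := fun _ hu =>
  (h.eventuallyEq_of_mem (hU.mem_nhds hu)).lineDeriv_eq

/-- A partial derivative only sees the function along a line, so it respects equality on a slice
`{u_j = p_j, j ∈ l}` as long as its own direction is not among the frozen coordinates. -/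
theorem partialDeriv_congr_slice (hU : IsOpen U) {p : Fin s → ℝ} {l : List (Fin s)}
    {F G : (Fin s → ℝ) → ℝ} (h : EqOn F G (U ∩ {u | ∀ j ∈ l, u j = p j})) {i : Fin s}
    (hi : i ∉ l) : EqOn (partialDeriv i F) (partialDeriv i G) (U ∩ {u | ∀ j ∈ l, u j = p j}) := by
  rintro u ⟨hu, hul⟩
  unfold partialDeriv lineDeriv
  apply Filter.EventuallyEq.deriv_eq
  have hc : ContinuousAt (fun t : ℝ => u + t • (Pi.single i 1 : Fin s → ℝ)) 0 := by fun_prop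
  have := hc.preimage_mem_nhds (t := U) (by simpa using hU.mem_nhds hu)
  filter_upwards [this] with t ht
  refine h ⟨ht, fun j hj => ?_⟩
  have : j ≠ i := fun e => hi (e ▸ hj)
  simp [this, hul j hj]

/-- An induction principle: what single partial derivatives preserve, iterated ones preserve. It
is stated for families of functions in order to cover relations between several functions. -/
theorem iteratedPartial_induction {ι : Type*} {P : (ι → (Fin s → ℝ) → ℝ) → Prop}
    (hP : ∀ i F, P F → P fun a => partialDeriv i (F a)) (n : Fin s → ℕ)
    {F : ι → (Fin s → ℝ) → ℝ} (hF : P F) : P fun a => iteratedPartial n (F a) := by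
  unfold iteratedPartial
  induction List.finRange s with
  | nil => exact hF
  | cons i l ih =>
    simp only [List.foldr_cons]
    generalize n i = m
    induction m with
    | zero => exact ih
    | succ m ihm => simpa only [Function.iterate_succ_apply'] using hP i _ ihm

theorem partialDeriv_sum (hU : IsOpen U) {ι : Type*} {S : Finset ι} (c : ι → ℝ)
    {F : ι → (Fin s → ℝ) → ℝ} (hF : ∀ a, ContDiffOn ℝ ∞ (F a) U) (i : Fin s) :
    EqOn (partialDeriv i fun u => ∑ a ∈ S, c a * F a u)
      (fun u => ∑ a ∈ S, c a * partialDeriv i (F a) u) U := by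
  intro u hu
  have hd : ∀ a, DifferentiableAt ℝ (F a) u := fun a =>
    ((hF a).contDiffAt (hU.mem_nhds hu)).differentiableAt (by simp)
  have hs : ContDiffOn ℝ ∞ (fun u => ∑ a ∈ S, c a * F a u) U :=
    ContDiffOn.sum fun a _ => contDiffOn_const.mul (hF a)
  simp only [partialDeriv_eq_fderiv hU hs i hu, partialDeriv_eq_fderiv hU (hF _) i hu]
  rw [fderiv_fun_sum fun a _ => (hd a).const_mul _]
  simp [fderiv_const_mul (hd _)]

theorem iteratedPartial_sum (hU : IsOpen U) {ι : Type*} {S : Finset ι} (c : ι → ℝ)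
    {F : ι → (Fin s → ℝ) → ℝ} (hF : ∀ a, ContDiffOn ℝ ∞ (F a) U) {G : (Fin s → ℝ) → ℝ}
    (hG : EqOn G (fun u => ∑ a ∈ S, c a * F a u) U) (n : Fin s → ℕ) :
    EqOn (iteratedPartial n G) (fun u => ∑ a ∈ S, c a * iteratedPartial n (F a) u) U := by
  refine (iteratedPartial_induction (ι := Option ι)
    (P := fun H => (∀ a, ContDiffOn ℝ ∞ (H (some a)) U) ∧
      EqOn (H none) (fun u => ∑ a ∈ S, c a * H (some a) u) U) ?_ n
    (F := fun o => o.elim G F) ⟨hF, hG⟩).2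
  rintro i H ⟨h1, h2⟩
  exact ⟨fun a => contDiffOn_partialDeriv hU (h1 a) i,
    (partialDeriv_congr hU h2 i).trans (partialDeriv_sum hU c h1 i)⟩

theorem norm_iteratedFDeriv_partialDeriv_le (hU : IsOpen U) {F : (Fin s → ℝ) → ℝ}
    (hF : ContDiffOn ℝ ∞ F U) (i : Fin s) {u : Fin s → ℝ} (hu : u ∈ U) (m : ℕ) :
    ‖iteratedFDeriv ℝ m (partialDeriv i F) u‖ ≤ ‖iteratedFDeriv ℝ (m + 1) F u‖ := by
  set L : ((Fin s → ℝ) →L[ℝ] ℝ) →L[ℝ] ℝ := ContinuousLinearMap.apply ℝ ℝ (Pi.single i 1) with hL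
  have hev : partialDeriv i F =ᶠ[𝓝 u] L ∘ fderiv ℝ F :=
    Filter.eventuallyEq_of_mem (hU.mem_nhds hu) fun v hv => partialDeriv_eq_fderiv hU hF i hv
  have hsm : ContDiffAt ℝ m (fderiv ℝ F) u :=
    ((hF.fderiv_of_isOpen hU (m := ∞) (by simp)).contDiffAt (hU.mem_nhds hu)).of_le
      (by exact_mod_cast le_top)
  have hLn : ‖L‖ ≤ 1 := by
    refine ContinuousLinearMap.opNorm_le_bound _ zero_le_one fun g => ?_
    refine (g.le_opNorm _).trans ?_
    rw [one_mul]
    exact mul_le_of_le_one_right (norm_nonneg _) (by simp [Pi.norm_single])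
  rw [(hev.iteratedFDeriv ℝ m).eq_of_nhds]
  calc _ ≤ ‖L‖ * ‖iteratedFDeriv ℝ m (fderiv ℝ F) u‖ :=
        L.norm_iteratedFDeriv_comp_left hsm le_rfl
    _ ≤ 1 * ‖iteratedFDeriv ℝ m (fderiv ℝ F) u‖ := by gcongr
    _ = _ := by rw [one_mul, norm_iteratedFDeriv_fderiv]

/-- The family `F` of functions has, at the point `p`, derivatives of each order that are bounded
by a polynomial in `N` times the weight `w`. -/
def HasPolynomialJets {Θ : Type*} (N : Θ → ℕ) (w : Θ → ℝ) (p : Fin s → ℝ)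
    (F : Θ → (Fin s → ℝ) → ℝ) : Prop :=
  ∀ m : ℕ, ∃ K : ℝ, ∃ d : ℕ, 0 ≤ K ∧
    ∀ t, ‖iteratedFDeriv ℝ m (F t) p‖ ≤ K * (N t + 1 : ℝ) ^ d * w t

theorem HasPolynomialJets.iteratedPartial {Θ : Type*} {N : Θ → ℕ} {w : Θ → ℝ} {p : Fin s → ℝ}
    {F : Θ → (Fin s → ℝ) → ℝ} (h : HasPolynomialJets N w p F) (hU : IsOpen U) (hp : p ∈ U)
    (hF : ∀ t, ContDiffOn ℝ ∞ (F t) U) (n : Fin s → ℕ) :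
    HasPolynomialJets N w p fun t => iteratedPartial n (F t) := by
  refine (iteratedPartial_induction
    (P := fun F => (∀ t, ContDiffOn ℝ ∞ (F t) U) ∧ HasPolynomialJets N w p F) ?_ n ⟨hF, h⟩).2
  rintro i G ⟨h1, h2⟩
  refine ⟨fun t => contDiffOn_partialDeriv hU (h1 t) i, fun m => ?_⟩
  obtain ⟨K, d, hK, hb⟩ := h2 (m + 1)
  exact ⟨K, d, hK, fun t =>
    (norm_iteratedFDeriv_partialDeriv_le hU (h1 t) i hp m).trans (hb t)⟩

end PartialDeriv

/-! ### Differentiating a power of the coordinates -/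

section Power

open scoped ContDiff

variable {s : ℕ} {U : Set (Fin s → ℝ)}

theorem partialDeriv_pow_mul (hU : IsOpen U) {H : (Fin s → ℝ) → ℝ} (hH : ContDiffOn ℝ ∞ H U)
    (p : Fin s → ℝ) (i l : Fin s) (m : ℕ) :
    EqOn (partialDeriv l fun u => (u i - p i) ^ (m + 1) * H u)
      (fun u => (u i - p i) ^ m *
        ((if i = l then (m + 1 : ℝ) * H u else 0) + (u i - p i) * partialDeriv l H u)) U := by
  intro u hu
  have hd : DifferentiableAt ℝ H u := (hH.contDiffAt (hU.mem_nhds hu)).differentiableAt (by simp)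
  have hline : HasDerivAt (fun t : ℝ => u + t • (Pi.single l 1 : Fin s → ℝ)) (Pi.single l 1) 0 := by
    simpa using ((hasDerivAt_id (0 : ℝ)).smul_const (Pi.single l 1 : Fin s → ℝ)).const_add u
  have h1 : HasDerivAt (fun t : ℝ => H (u + t • (Pi.single l 1 : Fin s → ℝ)))
      (partialDeriv l H u) 0 := hd.lineDifferentiableAt.hasDerivAt
  have h2 : HasDerivAt (fun t : ℝ => (u + t • (Pi.single l 1 : Fin s → ℝ)) i - p i)
      ((Pi.single l 1 : Fin s → ℝ) i) 0 := ((hasDerivAt_pi.1 hline) i).sub_const _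
  have h3 := ((h2.pow (m + 1)).mul h1).deriv
  unfold partialDeriv lineDeriv
  simp only [Pi.mul_def, Pi.pow_def] at h3
  rw [h3]
  by_cases hil : i = l
  · subst hil
    simp [partialDeriv, lineDeriv]; ring
  · simp [hil, partialDeriv, lineDeriv]; ring

/-- On the slice `u_i = p_i`, the `r`-th derivative of `(u_i - p_i)^r H` is `r! H`. -/
theorem iterate_partialDeriv_pow_mul (hU : IsOpen U) (p : Fin s → ℝ) (i : Fin s) (r : ℕ) :
    ∀ {H : (Fin s → ℝ) → ℝ}, ContDiffOn ℝ ∞ H U → ∀ u ∈ U, u i = p i →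
      (partialDeriv i)^[r] (fun u => (u i - p i) ^ r * H u) u = (r.factorial : ℝ) * H u := by
  induction r with
  | zero => intro H _ u _ _; simp
  | succ r ih =>
    intro H hH u hu hui
    rw [Function.iterate_succ_apply]
    have h1 := partialDeriv_pow_mul hU hH p i i r
    have hcongr : ∀ (k : ℕ) {F G : (Fin s → ℝ) → ℝ}, EqOn F G U →
        EqOn ((partialDeriv i)^[k] F) ((partialDeriv i)^[k] G) U := by
      intro k F G h
      induction k with
      | zero => exact h
      | succ k ihk => simpa only [Function.iterate_succ_apply'] using partialDeriv_congr hU ihk i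
    rw [hcongr r h1 hu, ih _ u hu hui]
    · simp [hui, Nat.factorial_succ]; ring
    · have := contDiffOn_partialDeriv hU hH i
      simp only [if_true]
      fun_prop

theorem iteratedPartial_prod_pow_mul (hU : IsOpen U) {p : Fin s → ℝ} (hp : p ∈ U)
    (k : Fin s → ℕ) {H : (Fin s → ℝ) → ℝ} (hH : ContDiffOn ℝ ∞ H U) :
    iteratedPartial k (fun u => (∏ i, (u i - p i) ^ k i) * H u) p =
      (∏ i, ((k i).factorial : ℝ)) * H p := by
  have key : ∀ l : List (Fin s), l.Nodup → ∀ H : (Fin s → ℝ) → ℝ, ContDiffOn ℝ ∞ H U →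
      EqOn (l.foldr (fun i G => (partialDeriv i)^[k i] G)
          fun u => (l.map fun i => (u i - p i) ^ k i).prod * H u)
        (fun u => (l.map fun i => ((k i).factorial : ℝ)).prod * H u)
        (U ∩ {u | ∀ j ∈ l, u j = p j}) := by
    intro l
    induction l with
    | nil => intro _ H _ u _; simp
    | cons i l ih =>
      intro hl H hH
      obtain ⟨hil, hl⟩ := List.nodup_cons.1 hl
      have h1 := ih hl (fun u => (u i - p i) ^ k i * H u) (by fun_prop)
      have hcongr : ∀ (m : ℕ) {F G : (Fin s → ℝ) → ℝ},
          EqOn F G (U ∩ {u | ∀ j ∈ l, u j = p j}) →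
          EqOn ((partialDeriv i)^[m] F) ((partialDeriv i)^[m] G)
            (U ∩ {u | ∀ j ∈ l, u j = p j}) := by
        intro m F G h
        induction m with
        | zero => exact h
        | succ m ihm =>
          simpa only [Function.iterate_succ_apply'] using partialDeriv_congr_slice hU ihm hil
      rintro u ⟨hu, hul⟩
      have h2 := hcongr (k i) h1 ⟨hu, fun j hj => hul j (List.mem_cons_of_mem _ hj)⟩
      simp only [List.map_cons, List.prod_cons, List.foldr_cons]
      have e1 : ∀ u : Fin s → ℝ, (u i - p i) ^ k i * (l.map fun i => (u i - p i) ^ k i).prod * H u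
          = (l.map fun i => (u i - p i) ^ k i).prod * ((u i - p i) ^ k i * H u) := by
        intro u; ring
      have e2 : ∀ u : Fin s → ℝ, (l.map fun i => ((k i).factorial : ℝ)).prod *
          ((u i - p i) ^ k i * H u) = (u i - p i) ^ k i *
          ((l.map fun i => ((k i).factorial : ℝ)).prod * H u) := by
        intro u; ring
      simp only [e1]
      rw [h2]
      simp only [e2]
      rw [iterate_partialDeriv_pow_mul hU p i (k i) (by fun_prop) u hu (hul i (by simp))]
      ring
  have := key (List.finRange s) (List.nodup_finRange s) H hH ⟨hp, fun _ _ => rfl⟩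
  simpa only [iteratedPartial, List.prod_ofFn, ← List.ofFn_eq_map] using this

theorem iteratedPartial_pow_mul_eq_zero (hU : IsOpen U) {p : Fin s → ℝ} (hp : p ∈ U)
    {n : Fin s → ℕ} {i : Fin s} {m : ℕ} (hm : n i < m) {H : (Fin s → ℝ) → ℝ}
    (hH : ContDiffOn ℝ ∞ H U) : iteratedPartial n (fun u => (u i - p i) ^ m * H u) p = 0 := by
  let Q : ℕ → ((Fin s → ℝ) → ℝ) → Prop := fun m G => ∃ H, ContDiffOn ℝ ∞ H U ∧
    EqOn G (fun u => (u i - p i) ^ m * H u) U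
  have step : ∀ (l : Fin s) (m : ℕ) (G : (Fin s → ℝ) → ℝ),
      Q (m + if l = i then 1 else 0) G → Q m (partialDeriv l G) := by
    rintro l m G ⟨H, hH, hG⟩
    have hsm := contDiffOn_partialDeriv hU hH l
    by_cases hl : l = i
    · subst hl
      simp only [if_true] at hG
      exact ⟨_, by simp only [if_true]; fun_prop,
        (partialDeriv_congr hU hG l).trans (partialDeriv_pow_mul hU hH p l l m)⟩
    · simp only [hl, if_false, add_zero] at hG
      refine ⟨partialDeriv l H, hsm, (partialDeriv_congr hU hG l).trans ?_⟩
      cases m with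
      | zero => intro u _; simp
      | succ m =>
        refine (partialDeriv_pow_mul hU hH p i l m).trans fun u _ => ?_
        simp only [Ne.symm hl, if_false]; ring
  have iter : ∀ (l : Fin s) (r m : ℕ) (G : (Fin s → ℝ) → ℝ),
      Q (m + if l = i then r else 0) G → Q m ((partialDeriv l)^[r] G) := by
    intro l r
    induction r with
    | zero => intro m G h; simpa using h
    | succ r ih =>
      intro m G h
      rw [Function.iterate_succ_apply]
      refine ih _ _ (step l _ _ ?_)
      by_cases hl : l = i <;> simp_all [add_assoc]
  have fold : ∀ (l : List (Fin s)) (m : ℕ) (G : (Fin s → ℝ) → ℝ), Q (m + l.count i * n i) G →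
      Q m (l.foldr (fun i G => (partialDeriv i)^[n i] G) G) := by
    intro l
    induction l with
    | nil => intro m G h; simpa using h
    | cons j l ih =>
      intro m G h
      rw [List.foldr_cons]
      refine iter _ _ _ _ (ih _ _ ?_)
      by_cases hj : j = i
      · subst hj
        simpa [add_mul, add_assoc, add_comm, add_left_comm] using h
      · simpa [hj] using h
  have hc : (List.finRange s).count i = 1 :=
    List.count_eq_one_of_mem (List.nodup_finRange s) (List.mem_finRange i)
  obtain ⟨R, -, hR⟩ := fold (List.finRange s) (m - n i) (fun u => (u i - p i) ^ m * H u)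
    ⟨H, hH, by rw [hc, one_mul, Nat.sub_add_cancel hm.le]; exact fun _ _ => rfl⟩
  have := hR hp
  simpa [iteratedPartial, Nat.sub_ne_zero_of_lt hm] using this

end Power

/-! ### Orbits on the real line -/

section Orbit

variable {s : ℕ}

/-- The orbit map `f_{ω|n}` on the real line. -/
def realOrbit (f : Fin (s + 1) → ℝ → ℝ) (ω : ℕ → Fin (s + 1)) : ℕ → ℝ → ℝ
  | 0, x => x
  | n + 1, x => f (ω n) (realOrbit f ω n x)

theorem orbitMap_coe (f : Fin (s + 1) → ℝ → ℝ) (ω : ℕ → Fin (s + 1)) (n : ℕ) (x : ℝ) :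
    orbitMap f ω n (x : EReal) = (realOrbit f ω n x : EReal) := by
  induction n with
  | zero => rfl
  | succ n ih => simp only [orbitMap, Function.comp, ih]; rfl

theorem orbitMap_top (f : Fin (s + 1) → ℝ → ℝ) (ω : ℕ → Fin (s + 1)) (n : ℕ) :
    orbitMap f ω n ⊤ = ⊤ := by
  induction n with
  | zero => rfl
  | succ n ih => simp only [orbitMap, Function.comp, ih]; rfl

theorem orbitMap_bot (f : Fin (s + 1) → ℝ → ℝ) (ω : ℕ → Fin (s + 1)) (n : ℕ) :
    orbitMap f ω n ⊥ = ⊥ := by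
  induction n with
  | zero => rfl
  | succ n ih => simp only [orbitMap, Function.comp, ih]; rfl

theorem shift_iterate_apply (ω : ℕ → Fin (s + 1)) (k n : ℕ) :
    shift^[k] ω n = ω (n + k) := by
  induction k generalizing ω with
  | zero => rfl
  | succ k ih => rw [Function.iterate_succ_apply, ih]; rfl

theorem realOrbit_add (f : Fin (s + 1) → ℝ → ℝ) (ω : ℕ → Fin (s + 1)) (k n : ℕ) (x : ℝ) :
    realOrbit f ω (n + k) x = realOrbit f (shift^[k] ω) n (realOrbit f ω k x) := by
  induction n with
  | zero => rw [Nat.zero_add]; rfl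
  | succ n ih => rw [Nat.succ_add]; simp only [realOrbit, ih, shift_iterate_apply]

theorem realOrbit_succ_left (f : Fin (s + 1) → ℝ → ℝ) (ω : ℕ → Fin (s + 1)) (n : ℕ) (x : ℝ) :
    realOrbit f ω (n + 1) x = realOrbit f (shift ω) n (f (ω 0) x) := realOrbit_add f ω 1 n x

/-- Expanding homeomorphisms of the line that satisfy the separating condition for `(a, b)` with
some room: the preimages of the enlarged interval `[a - η, b + η]` are still disjoint. All orbits
that stay bounded stay in `[a, b]`, hence at distance at least `η` from the boundary of the
enlarged interval. -/
structure IsSeparatedSystem (f : Fin (s + 1) → ℝ → ℝ) (a b η l : ℝ) : Prop where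
  lt : a < b
  room : 0 < η
  one_lt : 1 < l
  expand : ∀ i x y, x ≤ y → l * (y - x) ≤ f i y - f i x
  continuous : ∀ i, Continuous (f i)
  surjective : ∀ i, Function.Surjective (f i)
  left : ∀ i, f i a ≤ a
  right : ∀ i, b ≤ f i b
  disjoint : ∀ i j, i ≠ j → ∀ x, f i x ∈ Icc (a - η) (b + η) → f j x ∉ Icc (a - η) (b + η)

theorem exists_isSeparatedSystem {f : Fin (s + 1) → ℝ → ℝ} (hdiff : IsDiffeoFamily f)
    (hexp : IsExpanding f) (hsep : SeparatingCondition f) :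
    ∃ a b η l, IsSeparatedSystem f a b η l ∧ ∀ i x, l ≤ deriv (f i) x := by
  obtain ⟨l, hl, hderiv⟩ := hexp
  obtain ⟨a, b, hab, hinv, hdisj⟩ := hsep
  have hd : ∀ i, Differentiable ℝ (f i) := fun i => (hdiff.1 i).1.differentiable one_ne_zero
  choose g hg hgl hgr using fun i => (hdiff.1 i).2
  have hexpand : ∀ i x y, x ≤ y → l * (y - x) ≤ f i y - f i x := fun i x y hxy =>
    mul_sub_le_image_sub_of_le_deriv (hd i) (hderiv i) hxy
  have hmono : ∀ i, StrictMono (f i) := fun i x y hxy => by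
    nlinarith [hexpand i x y hxy.le]
  have hgm : ∀ i, StrictMono (g i) := fun i x y hxy => by
    rwa [← (hmono i).lt_iff_lt, hgr i, hgr i]
  have hcl : ∀ i, ∀ x, f i x ∈ Icc a b → x ∈ Icc a b := by
    intro i
    have h : f i ⁻¹' Icc a b = closure (f i ⁻¹' Ioo a b) := by
      rw [← closure_Ioo hab.ne]
      exact (IsHomeomorph.isOpenMap (f := f i) (by
        exact (Homeomorph.mk ⟨f i, g i, hgl i, hgr i⟩ (hd i).continuous
          (hg i).continuous).isHomeomorph)).preimage_closure_eq_closure_preimage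
          (hd i).continuous _
    intro x hx
    have hx' : x ∈ f i ⁻¹' Icc a b := hx
    rw [h] at hx'
    rw [← closure_Ioo hab.ne]
    exact closure_mono (hinv i) hx'
  have hleft : ∀ i, f i a ≤ a := fun i => by
    have := (hcl i (g i a) (by rw [hgr i]; exact ⟨le_rfl, hab.le⟩)).1
    simpa [hgr i a] using (hmono i).monotone this
  have hright : ∀ i, b ≤ f i b := fun i => by
    have := (hcl i (g i b) (by rw [hgr i]; exact ⟨hab.le, le_rfl⟩)).2
    simpa [hgr i b] using (hmono i).monotone this
  have hgap : ∀ i j, i ≠ j → g i b < g j a ∨ g j b < g i a := by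
    intro i j hij
    by_contra! hcon
    have hdj := hdisj i j hij
    rw [closure_Ioo hab.ne] at hdj
    have hle := fun i => (hgm i).monotone hab.le
    refine Set.disjoint_left.1 hdj (?_ : max (g i a) (g j a) ∈ f i ⁻¹' Icc a b) ?_
    · constructor
      · simpa [hgr i a] using (hmono i).monotone (le_max_left (g i a) (g j a))
      · simpa [hgr i b] using (hmono i).monotone (max_le (hle i) hcon.1)
    · constructor
      · simpa [hgr j a] using (hmono j).monotone (le_max_right (g i a) (g j a))
      · simpa [hgr j b] using (hmono j).monotone (max_le hcon.2 (hle j))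
  have hev : ∀ i j, g i b < g j a → ∀ᶠ η in 𝓝[>] (0 : ℝ), g i (b + η) < g j (a - η) := by
    intro i j h
    refine nhdsWithin_le_nhds ?_
    have c1 := (hg i).continuous
    have c2 := (hg j).continuous
    exact (by fun_prop : ContinuousAt (fun η => g i (b + η)) 0).eventually_lt
      (by fun_prop : ContinuousAt (fun η => g j (a - η)) 0) (by simpa using h)
  have hall : ∀ᶠ η in 𝓝[>] (0 : ℝ), ∀ i j, i ≠ j →
      g i (b + η) < g j (a - η) ∨ g j (b + η) < g i (a - η) := by
    refine eventually_all.2 fun i => eventually_all.2 fun j => ?_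
    by_cases hij : i = j
    · exact Eventually.of_forall fun _ h => absurd hij h
    · rcases hgap i j hij with h | h
      · exact (hev i j h).mono fun _ h _ => Or.inl h
      · exact (hev j i h).mono fun _ h _ => Or.inr h
  obtain ⟨η, hη, hη0⟩ := (hall.and self_mem_nhdsWithin).exists
  have hgle : ∀ i x y, f i x ≤ y → x ≤ g i y := fun i x y h => by
    rwa [← (hmono i).le_iff_le, hgr i]
  have hgge : ∀ i x y, y ≤ f i x → g i y ≤ x := fun i x y h => by
    rwa [← (hmono i).le_iff_le, hgr i]
  refine ⟨a, b, η, l, ⟨hab, hη0, hl, hexpand, fun i => (hd i).continuous,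
    fun i => (hgr i).surjective, hleft, hright, fun i j hij x hi hj => ?_⟩, hderiv⟩
  rcases hη i j hij with h | h
  · linarith [hgle i x _ hi.2, hgge j x _ hj.1]
  · linarith [hgle j x _ hj.2, hgge i x _ hi.1]

namespace IsSeparatedSystem

variable {f : Fin (s + 1) → ℝ → ℝ} {a b η l : ℝ}

theorem strictMono (h : IsSeparatedSystem f a b η l) (i : Fin (s + 1)) : StrictMono (f i) :=
  fun x y hxy => by nlinarith [h.expand i x y hxy.le, h.one_lt]

theorem lt_map (h : IsSeparatedSystem f a b η l) {c x : ℝ} (hc : 0 ≤ c) (hx : b + c < x)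
    (i : Fin (s + 1)) : b + c < f i x := by
  nlinarith [h.expand i b x (by linarith), h.one_lt, h.right i]

theorem map_lt (h : IsSeparatedSystem f a b η l) {c x : ℝ} (hc : 0 ≤ c) (hx : x < a - c)
    (i : Fin (s + 1)) : f i x < a - c := by
  nlinarith [h.expand i x a (by linarith), h.one_lt, h.left i]

theorem mem_of_map_mem (h : IsSeparatedSystem f a b η l) {c x : ℝ} (hc : 0 ≤ c)
    {i : Fin (s + 1)} (hx : f i x ∈ Icc (a - c) (b + c)) : x ∈ Icc (a - c) (b + c) :=
  ⟨not_lt.1 fun hlt => (h.map_lt hc hlt i).not_ge hx.1,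
    not_lt.1 fun hlt => (h.lt_map hc hlt i).not_ge hx.2⟩

theorem mem_of_realOrbit_mem (h : IsSeparatedSystem f a b η l) {c x : ℝ} (hc : 0 ≤ c)
    {ω : ℕ → Fin (s + 1)} {n m : ℕ} (hmn : m ≤ n)
    (hx : realOrbit f ω n x ∈ Icc (a - c) (b + c)) :
    realOrbit f ω m x ∈ Icc (a - c) (b + c) := by
  induction hmn with
  | refl => exact hx
  | step _ ih => exact ih (h.mem_of_map_mem hc hx)

theorem realOrbit_expand (h : IsSeparatedSystem f a b η l) (ω : ℕ → Fin (s + 1)) (n : ℕ)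
    {x y : ℝ} (hxy : x ≤ y) : l ^ n * (y - x) ≤ realOrbit f ω n y - realOrbit f ω n x := by
  induction n with
  | zero => simp [realOrbit]
  | succ n ih =>
    have h0 : 0 ≤ l ^ n * (y - x) :=
      mul_nonneg (pow_nonneg (by linarith [h.one_lt]) _) (by linarith)
    have := h.expand (ω n) _ _ (sub_nonneg.1 (h0.trans ih))
    have h2 := mul_le_mul_of_nonneg_left ih (by linarith [h.one_lt] : 0 ≤ l)
    simp only [realOrbit]
    rw [pow_succ']
    linarith

theorem realOrbit_surjective (h : IsSeparatedSystem f a b η l) (ω : ℕ → Fin (s + 1)) (n : ℕ) :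
    Function.Surjective (realOrbit f ω n) := by
  induction n with
  | zero => exact fun x => ⟨x, rfl⟩
  | succ n ih =>
    intro y
    obtain ⟨z, rfl⟩ := h.surjective (ω n) y
    obtain ⟨x, rfl⟩ := ih z
    exact ⟨x, rfl⟩

theorem realOrbit_continuous (h : IsSeparatedSystem f a b η l) (ω : ℕ → Fin (s + 1)) (n : ℕ) :
    Continuous (realOrbit f ω n) := by
  induction n with
  | zero => exact continuous_id
  | succ n ih => exact (h.continuous (ω n)).comp ih

theorem abs_realOrbit_expand (h : IsSeparatedSystem f a b η l) (ω : ℕ → Fin (s + 1)) (n : ℕ)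
    (x y : ℝ) : l ^ n * |y - x| ≤ |realOrbit f ω n y - realOrbit f ω n x| := by
  rcases le_total x y with hxy | hxy
  · rw [abs_of_nonneg (sub_nonneg.2 hxy)]
    exact (h.realOrbit_expand ω n hxy).trans (le_abs_self _)
  · rw [abs_sub_comm, abs_of_nonneg (sub_nonneg.2 hxy), abs_sub_comm]
    exact (h.realOrbit_expand ω n hxy).trans (le_abs_self _)

theorem le_realOrbit_right (h : IsSeparatedSystem f a b η l) (ω : ℕ → Fin (s + 1)) (n : ℕ) :
    b ≤ realOrbit f ω n b := by
  induction n with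
  | zero => exact le_rfl
  | succ n ih => exact (h.right (ω n)).trans ((h.strictMono (ω n)).monotone ih)

theorem realOrbit_left_le (h : IsSeparatedSystem f a b η l) (ω : ℕ → Fin (s + 1)) (n : ℕ) :
    realOrbit f ω n a ≤ a := by
  induction n with
  | zero => exact le_rfl
  | succ n ih => exact ((h.strictMono (ω n)).monotone ih).trans (h.left (ω n))

theorem tendsto_atTop_of_le (h : IsSeparatedSystem f a b η l) (ω : ℕ → Fin (s + 1)) {x y : ℝ}
    (hxy : x < y) (hx : ∀ n, a ≤ realOrbit f ω n x) :
    Tendsto (fun n => realOrbit f ω n y) atTop atTop := by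
  have h1 : Tendsto (fun n : ℕ => a + l ^ n * (y - x)) atTop atTop :=
    tendsto_atTop_add_const_left _ _
      ((tendsto_pow_atTop_atTop_of_one_lt h.one_lt).atTop_mul_const (by linarith))
  exact tendsto_atTop_mono (fun n => by linarith [h.realOrbit_expand ω n hxy.le, hx n]) h1

theorem tendsto_atBot_of_le (h : IsSeparatedSystem f a b η l) (ω : ℕ → Fin (s + 1)) {x y : ℝ}
    (hxy : y < x) (hx : ∀ n, realOrbit f ω n x ≤ b) :
    Tendsto (fun n => realOrbit f ω n y) atTop atBot := by
  have h1 : Tendsto (fun n : ℕ => -(l ^ n * (x - y)) + b) atTop atBot :=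
    tendsto_atBot_add_const_right _ _ (tendsto_neg_atTop_atBot.comp
      ((tendsto_pow_atTop_atTop_of_one_lt h.one_lt).atTop_mul_const (by linarith)))
  exact tendsto_atBot_mono (fun n => by linarith [h.realOrbit_expand ω n hxy.le, hx n]) h1

/-- Every sequence is the itinerary of a point whose whole orbit stays in `[a, b]`. -/
theorem exists_forall_realOrbit_mem (h : IsSeparatedSystem f a b η l) (ω : ℕ → Fin (s + 1)) :
    ∃ x, ∀ n, realOrbit f ω n x ∈ Icc a b := by
  have hz : Icc (a - 0) (b + 0) = Icc a b := by simp
  have hanti : ∀ n, realOrbit f ω (n + 1) ⁻¹' Icc a b ⊆ realOrbit f ω n ⁻¹' Icc a b := by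
    intro n x hx
    have := h.mem_of_realOrbit_mem le_rfl (n.le_succ) (x := x) (ω := ω) (by rw [hz]; exact hx)
    rwa [hz] at this
  obtain ⟨x, hx⟩ := IsCompact.nonempty_iInter_of_sequence_nonempty_isCompact_isClosed
    (fun n => realOrbit f ω n ⁻¹' Icc a b) hanti
    (fun n => (nonempty_Icc.2 h.lt.le).preimage (h.realOrbit_surjective ω n)) isCompact_Icc
    (fun n => isClosed_Icc.preimage (h.realOrbit_continuous ω n))
  exact ⟨x, fun n => mem_iInter.1 hx n⟩

/-- The fibre over `ω` consists of the single point whose orbit along `ω` stays in `[a, b]`. -/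
theorem fiber_eq (h : IsSeparatedSystem f a b η l) {Vp Vm : Set EReal}
    (hV : IsEscapePair f Vp Vm) {ω : ℕ → Fin (s + 1)} {x : ℝ}
    (hx : ∀ n, realOrbit f ω n x ∈ Icc a b) : fiber f (Vp ∪ Vm) ω = {(x : EReal)} := by
  have hesc : ∀ {z : EReal}, Tendsto (fun n => orbitMap f ω n z) atTop (𝓝 ⊤) ∨
      Tendsto (fun n => orbitMap f ω n z) atTop (𝓝 ⊥) → z ∉ fiber f (Vp ∪ Vm) ω := by
    intro z hz hmem
    have hev : ∀ᶠ n in atTop, orbitMap f ω n z ∈ Vp ∪ Vm := by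
      rcases hz with hz | hz
      · exact (hz.eventually_mem hV.top_mem).mono fun _ => Or.inl
      · exact (hz.eventually_mem hV.bot_mem).mono fun _ => Or.inr
    obtain ⟨n, hn⟩ := (tendsto_add_atTop_nat 1 |>.eventually hev).exists
    exact mem_iInter.1 hmem n hn
  ext z
  rw [mem_singleton_iff]
  constructor
  · intro hz
    by_contra hne
    refine hesc ?_ hz
    induction z with
    | bot => right; simp [orbitMap_bot]
    | top => left; simp [orbitMap_top]
    | coe z =>
      simp only [orbitMap_coe]
      rcases lt_or_gt_of_ne (fun e => hne (by rw [e]) : z ≠ x) with hlt | hlt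
      · right
        exact EReal.tendsto_coe_nhds_bot_iff.2
          (h.tendsto_atBot_of_le ω hlt fun n => (hx n).2)
      · left
        exact EReal.tendsto_coe_nhds_top_iff.2
          (h.tendsto_atTop_of_le ω hlt fun n => (hx n).1)
  · rintro rfl
    refine mem_iInter.2 fun n => ?_
    rw [mem_preimage, orbitMap_coe]
    rintro (hmem | hmem)
    · have := hV.tendsto_top _ hmem (shift^[n + 1] ω)
      simp only [orbitMap_coe, EReal.tendsto_coe_nhds_top_iff, ← realOrbit_add] at this
      obtain ⟨m, hm⟩ := (this.eventually_gt_atTop b).exists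
      exact absurd (hx _).2 (not_le.2 hm)
    · have := hV.tendsto_bot _ hmem (shift^[n + 1] ω)
      simp only [orbitMap_coe, EReal.tendsto_coe_nhds_bot_iff, ← realOrbit_add] at this
      obtain ⟨m, hm⟩ := (this.eventually_lt_atBot a).exists
      exact absurd (hx _).1 (not_le.2 hm)

theorem codingMap_eq (h : IsSeparatedSystem f a b η l) {Vp Vm : Set EReal}
    (hV : IsEscapePair f Vp Vm) {ω : ℕ → Fin (s + 1)} {x : ℝ}
    (hx : ∀ n, realOrbit f ω n x ∈ Icc a b) : codingMap f (Vp ∪ Vm) ω = x := by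
  have h1 : fiber f (Vp ∪ Vm) ω = {((codingMap f (Vp ∪ Vm) ω : ℝ) : EReal)} :=
    Classical.epsilon_spec (p := fun x : ℝ => fiber f (Vp ∪ Vm) ω = {(x : EReal)})
      ⟨x, h.fiber_eq hV hx⟩
  rw [h.fiber_eq hV hx, singleton_eq_singleton_iff] at h1
  exact_mod_cast h1.symm

end IsSeparatedSystem

end Orbit

/-! ### The functional equation of the escape probability -/

section Probability

variable {s : ℕ}

/-- Prepending a symbol to a sequence. -/
def consSeq (i : Fin (s + 1)) (ω : ℕ → Fin (s + 1)) : ℕ → Fin (s + 1)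
  | 0 => i
  | n + 1 => ω n

theorem measurable_consSeq :
    Measurable fun q : Fin (s + 1) × (ℕ → Fin (s + 1)) => consSeq q.1 q.2 := by
  refine measurable_pi_lambda _ fun n => ?_
  cases n with
  | zero => exact measurable_fst
  | succ n => exact (measurable_pi_apply n).comp measurable_snd

theorem isProbabilityMeasure_bernoulli {p : Fin s → ℝ} (hp : p ∈ paramSet s) :
    IsProbabilityMeasure (bernoulli p hp) := by
  unfold bernoulli; infer_instance

theorem bernoulli_eq_map_consSeq {p : Fin s → ℝ} (hp : p ∈ paramSet s) :
    bernoulli p hp = ((symbolLaw p hp).toMeasure.prod (bernoulli p hp)).map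
      fun q => consSeq q.1 q.2 := by
  have := isProbabilityMeasure_bernoulli hp
  refine (Measure.eq_infinitePi _ fun S t ht => ?_).symm
  have hpre : (fun q : Fin (s + 1) × (ℕ → Fin (s + 1)) => consSeq q.1 q.2) ⁻¹' Set.pi S t =
      (if 0 ∈ S then t 0 else univ) ×ˢ
        Set.pi ((S.erase 0).preimage Nat.succ Nat.succ_injective.injOn : Finset ℕ)
          fun n => t (n + 1) := by
    ext ⟨i, ω⟩
    constructor
    · intro hq
      refine ⟨?_, fun n hn => ?_⟩
      · by_cases h0 : 0 ∈ S
        · simpa [h0, consSeq] using hq 0 h0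
        · simp [h0]
      · have hn' : n + 1 ∈ S := by simpa using hn
        exact hq (n + 1) hn'
    · rintro ⟨h1, h2⟩ n hn
      cases n with
      | zero =>
        have : (0 : ℕ) ∈ S := hn
        simpa [this, consSeq] using h1
      | succ n => exact h2 n (by simpa using hn)
  rw [Measure.map_apply measurable_consSeq (MeasurableSet.pi S.countable_toSet fun n _ => ht n),
    hpre, Measure.prod_prod, bernoulli, Measure.infinitePi_pi _ fun n _ => ht (n + 1),
    Finset.prod_preimage Nat.succ (S.erase 0) Nat.succ_injective.injOn
      (fun n => (symbolLaw p hp).toMeasure (t n))]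
  · by_cases h0 : 0 ∈ S
    · rw [if_pos h0, Finset.mul_prod_erase S (fun n => (symbolLaw p hp).toMeasure (t n)) h0]
    · simp [h0, Finset.erase_eq_of_notMem]
  · intro n hn hr
    cases n with
    | zero => simp at hn
    | succ n => exact absurd ⟨n, rfl⟩ hr

theorem bernoulli_real_eq_sum {p : Fin s → ℝ} (hp : p ∈ paramSet s)
    {E : Set (ℕ → Fin (s + 1))} (hE : MeasurableSet E) :
    (bernoulli p hp).real E = ∑ i, probVec p i * (bernoulli p hp).real (consSeq i ⁻¹' E) := by
  have := isProbabilityMeasure_bernoulli hp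
  have h1 : bernoulli p hp E =
      ∑ i, ENNReal.ofReal (probVec p i) * bernoulli p hp (consSeq i ⁻¹' E) := by
    conv_lhs => rw [bernoulli_eq_map_consSeq hp]
    rw [Measure.map_apply measurable_consSeq hE,
      Measure.prod_apply (measurable_consSeq hE), lintegral_fintype]
    refine Finset.sum_congr rfl fun i _ => ?_
    rw [PMF.toMeasure_apply_singleton _ _ (measurableSet_singleton i), mul_comm]
    rfl
  rw [measureReal_def, h1, ENNReal.toReal_sum fun i _ => by finiteness]
  refine Finset.sum_congr rfl fun i _ => ?_
  rw [ENNReal.toReal_mul, ENNReal.toReal_ofReal (probVec_pos hp i).le, measureReal_def]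

variable {f : Fin (s + 1) → ℝ → ℝ} {a b η l : ℝ}

theorem probInfty_coe {u : Fin s → ℝ} (hu : u ∈ paramSet s) (x : ℝ) :
    probInfty f u x = (bernoulli u hu).real
      {ω | Tendsto (fun n => realOrbit f ω n x) atTop atTop} := by
  simp only [probInfty, hu, dif_pos, orbitMap_coe, EReal.tendsto_coe_nhds_top_iff]

theorem probInfty_nonneg (u : Fin s → ℝ) (x : EReal) : 0 ≤ probInfty f u x := by
  unfold probInfty; split_ifs <;> positivity

theorem probInfty_le_one (u : Fin s → ℝ) (x : EReal) : probInfty f u x ≤ 1 := by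
  unfold probInfty
  split_ifs with hu
  · have := isProbabilityMeasure_bernoulli hu
    exact measureReal_le_one
  · exact zero_le_one

namespace IsSeparatedSystem

theorem probInfty_eq_one (h : IsSeparatedSystem f a b η l) {u : Fin s → ℝ} (hu : u ∈ paramSet s)
    {x : ℝ} (hx : b < x) : probInfty f u x = 1 := by
  have := isProbabilityMeasure_bernoulli hu
  have huniv : {ω | Tendsto (fun n => realOrbit f ω n x) atTop atTop} = univ :=
    eq_univ_of_forall fun ω => h.tendsto_atTop_of_le ω hx
      fun n => h.lt.le.trans (h.le_realOrbit_right ω n)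
  rw [probInfty_coe hu, huniv, probReal_univ]

theorem probInfty_eq_zero (h : IsSeparatedSystem f a b η l) {u : Fin s → ℝ}
    (hu : u ∈ paramSet s) {x : ℝ} (hx : x < a) : probInfty f u x = 0 := by
  have hempty : {ω | Tendsto (fun n => realOrbit f ω n x) atTop atTop} = ∅ :=
    eq_empty_of_forall_notMem fun ω hω => (h.tendsto_atBot_of_le ω hx
      fun n => (h.realOrbit_left_le ω n).trans h.lt.le).not_tendsto disjoint_atBot_atTop hω
  rw [probInfty_coe hu, hempty, measureReal_empty]

theorem measurable_realOrbit (h : IsSeparatedSystem f a b η l) (n : ℕ) (x : ℝ) :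
    Measurable fun ω => realOrbit f ω n x := by
  induction n with
  | zero => exact measurable_const
  | succ n ih =>
    have h1 : Measurable fun q : Fin (s + 1) × ℝ => f q.1 q.2 :=
      measurable_from_prod_countable_right fun i => (h.continuous i).measurable
    exact h1.comp ((measurable_pi_apply n).prodMk ih)

/-- The escape probability satisfies the self-similarity equation of the random walk. -/
theorem probInfty_eq_sum (h : IsSeparatedSystem f a b η l) {u : Fin s → ℝ}
    (hu : u ∈ paramSet s) (x : ℝ) :
    probInfty f u x = ∑ i, probVec u i * probInfty f u (f i x : ℝ) := by
  simp only [probInfty_coe hu]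
  rw [bernoulli_real_eq_sum hu (measurableSet_tendsto atTop fun n => h.measurable_realOrbit n x)]
  refine Finset.sum_congr rfl fun i _ => ?_
  congr 2
  ext ω
  simp only [mem_preimage, mem_ofPred_eq]
  rw [← tendsto_add_atTop_iff_nat 1]
  simp only [realOrbit_succ_left]
  rfl

/-- For two points in one cylinder of the first level, the increment of the escape probability
is the weight of the cylinder times the increment between the images. -/
theorem probInfty_sub_eq_mul (h : IsSeparatedSystem f a b η l) {u : Fin s → ℝ}
    (hu : u ∈ paramSet s) {x y : ℝ} {i : Fin (s + 1)} (hx : f i x ∈ Icc (a - η) (b + η))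
    (hy : f i y ∈ Icc (a - η) (b + η)) :
    probInfty f u y - probInfty f u x =
      probVec u i * (probInfty f u (f i y : ℝ) - probInfty f u (f i x : ℝ)) := by
  -- Under any other map both points leave the enlarged interval, and on the same side: a point
  -- between them would otherwise lie in two first-level cylinders.
  have key : ∀ x y, f i x ∈ Icc (a - η) (b + η) → f i y ∈ Icc (a - η) (b + η) → x ≤ y →
      ∀ j ≠ i, probInfty f u (f j y : ℝ) = probInfty f u (f j x : ℝ) := by
    intro x y hx hy hxy j hj
    have hr := h.room
    have hxj := h.disjoint i j hj.symm x hx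
    have hyj := h.disjoint i j hj.symm y hy
    have hm := (h.strictMono j).monotone hxy
    simp only [mem_Icc, not_and_or, not_le] at hxj hyj
    rcases hyj with hyj | hyj
    · rw [h.probInfty_eq_zero hu (by linarith), h.probInfty_eq_zero hu (by linarith)]
    rcases hxj with hxj | hxj
    · obtain ⟨z, hz, hzj⟩ := intermediate_value_Icc hxy (h.continuous j).continuousOn
        (⟨by linarith [h.lt], by linarith⟩ : b ∈ Icc (f j x) (f j y))
      refine absurd ?_ (h.disjoint i j hj.symm z ⟨hx.1.trans ?_, le_trans ?_ hy.2⟩)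
      · rw [hzj]; exact ⟨by linarith [h.lt], by linarith⟩
      · exact (h.strictMono i).monotone hz.1
      · exact (h.strictMono i).monotone hz.2
    · rw [h.probInfty_eq_one hu (by linarith), h.probInfty_eq_one hu (by linarith)]
  have key' : ∀ j ≠ i, probInfty f u (f j y : ℝ) = probInfty f u (f j x : ℝ) := by
    rcases le_total x y with hxy | hxy
    · exact key x y hx hy hxy
    · exact fun j hj => (key y x hy hx hxy j hj).symm
  rw [h.probInfty_eq_sum hu y, h.probInfty_eq_sum hu x, ← Finset.sum_sub_distrib,
    Finset.sum_eq_single i]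
  · ring
  · intro j _ hj; rw [key' j hj, sub_self]
  · simp

theorem probInfty_sub_eq_prod_mul (h : IsSeparatedSystem f a b η l) {u : Fin s → ℝ}
    (hu : u ∈ paramSet s) {x y : ℝ} (ω : ℕ → Fin (s + 1)) (n : ℕ)
    (hx : realOrbit f ω n x ∈ Icc (a - η) (b + η))
    (hy : realOrbit f ω n y ∈ Icc (a - η) (b + η)) :
    probInfty f u y - probInfty f u x = (∏ k ∈ Finset.range n, probVec u (ω k)) *
      (probInfty f u (realOrbit f ω n y : ℝ) - probInfty f u (realOrbit f ω n x : ℝ)) := by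
  induction n with
  | zero => simp [realOrbit]
  | succ n ih =>
    rw [ih (h.mem_of_realOrbit_mem h.room.le n.le_succ hx)
      (h.mem_of_realOrbit_mem h.room.le n.le_succ hy), Finset.prod_range_succ, mul_assoc,
      h.probInfty_sub_eq_mul hu hx hy]
    rfl

/-- Every finite word is realised as an increment of the escape probability. -/
theorem exists_probInfty_sub_eq_word (h : IsSeparatedSystem f a b η l)
    (τ : List (Fin (s + 1))) : ∃ z₁ ∈ Icc (a - η) (b + η), ∃ z₂ ∈ Icc (a - η) (b + η),
      ∀ u ∈ paramSet s, probInfty f u z₂ - probInfty f u z₁ = (τ.map (probVec u)).prod := by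
  induction τ with
  | nil =>
    have hr := h.room
    have hlt := h.lt
    refine ⟨a - η, ⟨le_rfl, by linarith⟩, b + η, ⟨by linarith, le_rfl⟩, fun u hu => ?_⟩
    rw [h.probInfty_eq_one hu (by linarith), h.probInfty_eq_zero hu (by linarith)]
    simp
  | cons i τ ih =>
    obtain ⟨w₁, hw₁, w₂, hw₂, hw⟩ := ih
    obtain ⟨z₁, rfl⟩ := h.surjective i w₁
    obtain ⟨z₂, rfl⟩ := h.surjective i w₂
    refine ⟨z₁, h.mem_of_map_mem h.room.le hw₁, z₂, h.mem_of_map_mem h.room.le hw₂,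
      fun u hu => ?_⟩
    rw [h.probInfty_sub_eq_mul hu hw₁ hw₂, hw u hu, List.map_cons, List.prod_cons]

end IsSeparatedSystem

end Probability

/-! ### Smooth dependence of the escape probability on the parameters -/

section Smoothness

open scoped ContDiff

variable {s : ℕ}

theorem isOpen_paramSet (s : ℕ) : IsOpen (paramSet s) := by
  have h1 : IsOpen {p : Fin s → ℝ | ∀ i, p i ∈ Ioo (0 : ℝ) 1} := by
    simp only [ofPred_forall]
    exact isOpen_iInter_of_finite fun i => isOpen_Ioo.preimage (continuous_apply i)
  have h2 : IsOpen {p : Fin s → ℝ | ∑ i, p i < 1} :=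
    isOpen_lt (continuous_finsetSum _ fun i _ => continuous_apply i) continuous_const
  exact h1.inter h2

theorem contDiff_probVec (i : Fin (s + 1)) {n : ℕ∞ω} :
    ContDiff ℝ n fun u : Fin s → ℝ => probVec u i := by
  induction i using Fin.lastCases with
  | last => simp only [probVec, Fin.snoc_last]; fun_prop
  | cast i => simp only [probVec, Fin.snoc_castSucc]; fun_prop

theorem probVec_lt_one (hs : 1 ≤ s) {u : Fin s → ℝ} (hu : u ∈ paramSet s) (i : Fin (s + 1)) :
    probVec u i < 1 := by
  have : Nontrivial (Fin (s + 1)) := Fin.nontrivial_iff_two_le.2 (by omega)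
  obtain ⟨j, hj⟩ := exists_ne i
  have h1 := Finset.add_le_sum (fun k _ => (probVec_pos hu k).le) (Finset.mem_univ i)
    (Finset.mem_univ j) hj.symm
  rw [sum_probVec] at h1
  linarith [probVec_pos hu j]

/-- The Banach space of bounded functions on the line, without any regularity. -/
abbrev BoundedFun : Type := lp (fun _ : ℝ => ℝ) ∞

/-- The bounded function given by a function with a uniform bound. -/
def BoundedFun.mk (g : ℝ → ℝ) (c : ℝ) (hg : ∀ x, |g x| ≤ c) : BoundedFun :=
  ⟨g, memℓp_infty ⟨c, by rintro _ ⟨x, rfl⟩; exact hg x⟩⟩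

theorem BoundedFun.abs_apply_le (g : BoundedFun) (x : ℝ) : |g x| ≤ ‖g‖ :=
  lp.norm_apply_le_norm ENNReal.top_ne_zero g x

theorem BoundedFun.norm_le {g : BoundedFun} {c : ℝ} (hc : 0 ≤ c) (h : ∀ x, |g x| ≤ c) : ‖g‖ ≤ c :=
  lp.norm_le_of_forall_le hc h

/-- The operator `g ↦ 1_S(φ) · g ∘ φ` on bounded functions. -/
def pullbackOn (φ : ℝ → ℝ) (S : Set ℝ) : BoundedFun →L[ℝ] BoundedFun :=
  LinearMap.mkContinuous
    { toFun := fun g => BoundedFun.mk ((φ ⁻¹' S).indicator fun x => g (φ x)) ‖g‖ fun x => by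
        by_cases hx : x ∈ φ ⁻¹' S
        · rw [indicator_of_mem hx]; exact g.abs_apply_le _
        · rw [indicator_of_notMem hx, abs_zero]; exact norm_nonneg g
      map_add' := fun g₁ g₂ => by
        refine lp.ext (funext fun x => ?_)
        change (φ ⁻¹' S).indicator (fun x => g₁ (φ x) + g₂ (φ x)) x =
          (φ ⁻¹' S).indicator (fun x => g₁ (φ x)) x + (φ ⁻¹' S).indicator (fun x => g₂ (φ x)) x
        by_cases hx : x ∈ φ ⁻¹' S <;> simp [hx]
      map_smul' := fun c g => by
        ext x
        by_cases hx : x ∈ φ ⁻¹' S <;> simp [BoundedFun.mk, hx] }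
    1 fun g => by
      rw [one_mul]
      refine BoundedFun.norm_le (norm_nonneg g) fun x => ?_
      by_cases hx : x ∈ φ ⁻¹' S
      · simpa [BoundedFun.mk, hx] using g.abs_apply_le _
      · simp [BoundedFun.mk, hx]

theorem pullbackOn_apply (φ : ℝ → ℝ) (S : Set ℝ) (g : BoundedFun) (x : ℝ) :
    pullbackOn φ S g x = (φ ⁻¹' S).indicator (fun x => g (φ x)) x := rfl

/-- The increment `g ↦ g y - g x` as a continuous functional. -/
def incrementCLM (x y : ℝ) : BoundedFun →L[ℝ] ℝ :=
  LinearMap.mkContinuous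
    { toFun := fun g => g y - g x
      map_add' := fun g₁ g₂ => by simp only [lp.coeFn_add, Pi.add_apply]; ring
      map_smul' := fun c g => by
        simp only [lp.coeFn_smul, Pi.smul_apply, smul_eq_mul, RingHom.id_apply]; ring }
    2 fun g => by
      have h1 := g.abs_apply_le x
      have h2 := g.abs_apply_le y
      have h3 := abs_sub (g y) (g x)
      simp only [LinearMap.coe_mk, AddHom.coe_mk, Real.norm_eq_abs]
      linarith

theorem norm_incrementCLM_le (x y : ℝ) : ‖incrementCLM x y‖ ≤ 2 :=
  LinearMap.mkContinuous_norm_le _ zero_le_two _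

/-- The function `x ↦ T_u(x)` as an element of the space of bounded functions. -/
def escapeFun (f : Fin (s + 1) → ℝ → ℝ) (u : Fin s → ℝ) : BoundedFun :=
  BoundedFun.mk (fun x => probInfty f u x) 1 fun x => by
    rw [abs_of_nonneg (probInfty_nonneg u _)]; exact probInfty_le_one u _

variable {f : Fin (s + 1) → ℝ → ℝ} {a b η l : ℝ}

/-- As the sets `f_i⁻¹[a - η, b + η]` are disjoint, the transfer operator of the functional
equation is a strict contraction on bounded functions. -/
theorem IsSeparatedSystem.norm_sum_pullbackOn_lt_one (h : IsSeparatedSystem f a b η l)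
    (hs : 1 ≤ s) {u : Fin s → ℝ} (hu : u ∈ paramSet s) :
    ‖∑ i, probVec u i • pullbackOn (f i) (Icc (a - η) (b + η))‖ < 1 := by
  obtain ⟨i₀, hi₀⟩ := Finite.exists_max (probVec u)
  refine (ContinuousLinearMap.opNorm_le_bound _ (probVec_pos hu i₀).le fun g => ?_).trans_lt
    (probVec_lt_one hs hu i₀)
  refine BoundedFun.norm_le (mul_nonneg (probVec_pos hu i₀).le (norm_nonneg g)) fun x => ?_
  have hsum : (∑ i, probVec u i • pullbackOn (f i) (Icc (a - η) (b + η))) g x =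
      ∑ i, probVec u i * (f i ⁻¹' Icc (a - η) (b + η)).indicator (fun x => g (f i x)) x := by
    simp only [sum_apply, smul_apply, lp.coeFn_sum, Finset.sum_apply, lp.coeFn_smul,
      Pi.smul_apply, smul_eq_mul, pullbackOn_apply]
  rw [hsum]
  by_cases hx : ∃ i, f i x ∈ Icc (a - η) (b + η)
  · obtain ⟨i, hi⟩ := hx
    rw [Finset.sum_eq_single i, indicator_of_mem (mem_preimage.2 hi), abs_mul,
      abs_of_pos (probVec_pos hu i)]
    · exact mul_le_mul (hi₀ i) (g.abs_apply_le _) (abs_nonneg _) (probVec_pos hu i₀).le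
    · intro j _ hj
      rw [indicator_of_notMem (s := f j ⁻¹' _) (h.disjoint i j hj.symm x hi), mul_zero]
    · simp
  · push Not at hx
    rw [Finset.sum_eq_zero fun i _ => by rw [indicator_of_notMem (s := f i ⁻¹' _) (hx i), mul_zero], abs_zero]
    exact mul_nonneg (probVec_pos hu i₀).le (norm_nonneg g)

/-- The escape probability, as a bounded function of the starting point, depends smoothly on the
parameters: solving the functional equation amounts to inverting an operator that is affine in
the parameters. -/
theorem IsSeparatedSystem.contDiffOn_escapeFun (h : IsSeparatedSystem f a b η l) (hs : 1 ≤ s) :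
    ContDiffOn ℝ ∞ (escapeFun f) (paramSet s) := by
  set A : (Fin s → ℝ) → BoundedFun →L[ℝ] BoundedFun := fun u =>
    ∑ i, probVec u i • pullbackOn (f i) (Icc (a - η) (b + η)) with hA
  let e : Fin (s + 1) → BoundedFun := fun i =>
    BoundedFun.mk ((f i ⁻¹' Ioi (b + η)).indicator fun _ => 1) 1 fun x => by
      by_cases hx : x ∈ f i ⁻¹' Ioi (b + η)
      · rw [indicator_of_mem hx, abs_one]
      · rw [indicator_of_notMem hx, abs_zero]; exact zero_le_one
  have hAsm : ContDiff ℝ ∞ A := ContDiff.sum fun i _ => (contDiff_probVec i).smul contDiff_const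
  have hesm : ContDiff ℝ ∞ fun u : Fin s → ℝ => ∑ i, probVec u i • e i :=
    ContDiff.sum fun i _ => (contDiff_probVec i).smul contDiff_const
  have hunit : ∀ u ∈ paramSet s, IsUnit (1 - A u) := fun u hu =>
    isUnit_one_sub_of_norm_lt_one (h.norm_sum_pullbackOn_lt_one hs hu)
  have hfix : ∀ u ∈ paramSet s, (1 - A u) (escapeFun f u) = ∑ i, probVec u i • e i := by
    intro u hu
    have hr := h.room
    rw [sub_apply, one_apply_eq_self, sub_eq_iff_eq_add']
    ext x
    have h1 : escapeFun f u x = probInfty f u x := rfl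
    rw [h1, h.probInfty_eq_sum hu]
    simp only [hA, lp.coeFn_add, Pi.add_apply, sum_apply, smul_apply,
      lp.coeFn_sum, Finset.sum_apply, lp.coeFn_smul, Pi.smul_apply, smul_eq_mul,
      pullbackOn_apply]
    rw [← Finset.sum_add_distrib]
    refine Finset.sum_congr rfl fun i _ => ?_
    rw [← mul_add]
    congr 1
    simp only [e, BoundedFun.mk, escapeFun]
    by_cases hJ : f i x ∈ Icc (a - η) (b + η)
    · have h2 : ¬ b + η < f i x := not_lt.2 hJ.2
      rw [indicator_of_mem (mem_preimage.2 hJ), indicator_of_notMem (by simpa using h2)]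
      simp
    · rw [indicator_of_notMem (s := f i ⁻¹' _) hJ, zero_add]
      by_cases h2 : b + η < f i x
      · rw [indicator_of_mem (s := f i ⁻¹' Ioi _) h2, h.probInfty_eq_one hu (by linarith)]
      · rw [indicator_of_notMem (s := f i ⁻¹' Ioi _) h2, h.probInfty_eq_zero hu]
        simp only [mem_Icc, not_and_or, not_le] at hJ
        rcases hJ with hJ | hJ <;> linarith
  have hsol : ∀ u ∈ paramSet s,
      escapeFun f u = Ring.inverse (1 - A u) (∑ i, probVec u i • e i) := by
    intro u hu
    rw [← hfix u hu, ← mul_apply_eq_comp, Ring.inverse_mul_cancel _ (hunit u hu),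
      one_apply_eq_self]
  refine ContDiffOn.congr (fun u hu => ContDiffAt.contDiffWithinAt ?_) hsol
  obtain ⟨w, hw⟩ := hunit u hu
  have hinv : ContDiffAt ℝ ∞ (fun u => Ring.inverse (1 - A u)) u := by
    refine ContDiffAt.comp u (g := Ring.inverse) ?_ (contDiff_const.sub hAsm).contDiffAt
    rw [← hw]
    exact contDiffAt_ringInverse ℝ w
  exact hinv.clm_apply hesm.contDiffAt

theorem IsSeparatedSystem.contDiffOn_probInfty (h : IsSeparatedSystem f a b η l) (hs : 1 ≤ s)
    (x : ℝ) : ContDiffOn ℝ ∞ (fun u => probInfty f u x) (paramSet s) := by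
  have hm : ContDiffOn ℝ ∞ (fun u => incrementCLM (a - 1) x (escapeFun f u)) (paramSet s) :=
    (incrementCLM (a - 1) x).contDiff.comp_contDiffOn (h.contDiffOn_escapeFun hs)
  refine hm.congr fun u hu => ?_
  change _ = probInfty f u x - probInfty f u ((a - 1 : ℝ) : EReal)
  rw [h.probInfty_eq_zero hu (x := a - 1) (by linarith), sub_zero]

/-- The parameter derivatives of the escape probability are bounded uniformly in the starting
point. -/
theorem IsSeparatedSystem.exists_norm_iteratedFDeriv_le (h : IsSeparatedSystem f a b η l)
    (hs : 1 ≤ s) {p : Fin s → ℝ} (hp : p ∈ paramSet s) (m : ℕ) : ∃ K : ℝ, 0 ≤ K ∧ ∀ x y : ℝ,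
      ‖iteratedFDeriv ℝ m (fun u => probInfty f u y - probInfty f u x) p‖ ≤ K := by
  refine ⟨2 * ‖iteratedFDeriv ℝ m (escapeFun f) p‖, by positivity, fun x y => ?_⟩
  have hat : ContDiffAt ℝ m (escapeFun f) p :=
    ((h.contDiffOn_escapeFun hs).contDiffAt ((isOpen_paramSet s).mem_nhds hp)).of_le
      (by exact_mod_cast le_top)
  refine ((incrementCLM x y).norm_iteratedFDeriv_comp_left hat le_rfl).trans ?_
  gcongr
  exact norm_incrementCLM_le x y

theorem contDiff_prod_probVec (v : ℕ → Fin (s + 1)) (n : ℕ) {k : ℕ∞ω} :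
    ContDiff ℝ k fun u : Fin s → ℝ => ∏ j ∈ Finset.range n, probVec u (v j) :=
  contDiff_prod fun j _ => contDiff_probVec (v j)

/-- A derivative of order `m` of the weight of a word of length `n` is at most `(L n)^m` times
the weight. -/
theorem exists_norm_iteratedFDeriv_prod_le {p : Fin s → ℝ} (hp : p ∈ paramSet s) :
    ∃ L : ℝ, 0 ≤ L ∧ ∀ (v : ℕ → Fin (s + 1)) (n m : ℕ),
      ‖iteratedFDeriv ℝ m (fun u => ∏ j ∈ Finset.range n, probVec u (v j)) p‖ ≤
        (L * n) ^ m * ∏ j ∈ Finset.range n, probVec p (v j) := by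
  set D : Fin (s + 1) → ℝ := fun i => ‖iteratedFDeriv ℝ 1 (fun u => probVec u i) p‖ with hD
  have hD0 : ∀ i, 0 ≤ D i / probVec p i := fun i =>
    div_nonneg (norm_nonneg _) (probVec_pos hp i).le
  refine ⟨∑ i, D i / probVec p i, Finset.sum_nonneg fun i _ => hD0 i, fun v n => ?_⟩
  set L := ∑ i, D i / probVec p i with hL
  have hL0 : 0 ≤ L := Finset.sum_nonneg fun i _ => hD0 i
  have hDL : ∀ i, D i ≤ L * probVec p i := fun i => by
    rw [← div_le_iff₀ (probVec_pos hp i)]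
    exact Finset.single_le_sum (fun j _ => hD0 j) (Finset.mem_univ i)
  -- The coordinates of the probability vector are affine in the parameters.
  have hhigh : ∀ (i : Fin (s + 1)) (k : ℕ), 2 ≤ k →
      iteratedFDeriv ℝ k (fun u : Fin s → ℝ => probVec u i) p = 0 := by
    intro i k hk
    obtain ⟨k, rfl⟩ := Nat.exists_eq_add_of_le' hk
    have hc : ∃ φ : (Fin s → ℝ) →L[ℝ] ℝ, ∀ u, fderiv ℝ (fun u : Fin s → ℝ => probVec u i) u = φ := by
      induction i using Fin.lastCases with
      | last =>
        refine ⟨-∑ j, ContinuousLinearMap.proj j, fun u => ?_⟩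
        have : HasFDerivAt (fun u : Fin s → ℝ => 1 - ∑ j, u j)
            (-∑ j, ContinuousLinearMap.proj (R := ℝ) (φ := fun _ : Fin s => ℝ) j) u :=
          (HasFDerivAt.fun_sum fun j _ => hasFDerivAt_apply j u).const_sub 1
        simpa only [probVec, Fin.snoc_last] using this.fderiv
      | cast i =>
        refine ⟨ContinuousLinearMap.proj i, fun u => ?_⟩
        simpa only [probVec, Fin.snoc_castSucc] using (hasFDerivAt_apply (𝕜 := ℝ) i u).fderiv
    obtain ⟨φ, hφ⟩ := hc
    rw [← norm_eq_zero, ← norm_iteratedFDeriv_fderiv, funext hφ,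
      iteratedFDeriv_const_of_ne (Nat.succ_ne_zero k)]
    simp
  induction n with
  | zero =>
    intro m
    cases m with
    | zero => simp
    | succ m =>
      simp only [Finset.range_zero, Finset.prod_empty]
      rw [iteratedFDeriv_const_of_ne (Nat.succ_ne_zero m)]
      simp
  | succ n ih =>
    intro m
    set w := ∏ j ∈ Finset.range n, probVec p (v j) with hw
    have hw0 : 0 < w := Finset.prod_pos fun j _ => probVec_pos hp _
    set q := probVec p (v n) with hq
    have hq0 : 0 < q := probVec_pos hp _
    simp only [Finset.prod_range_succ]
    refine (norm_iteratedFDeriv_mul_le (N := ∞) (contDiff_prod_probVec v n)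
      (contDiff_probVec (v n)) p (by exact_mod_cast le_top)).trans ?_
    have hzero : ‖iteratedFDeriv ℝ 0 (fun u : Fin s → ℝ => probVec u (v n)) p‖ = q := by
      rw [norm_iteratedFDeriv_zero, Real.norm_eq_abs, abs_of_pos hq0]
    cases m with
    | zero =>
      simp only [zero_add, Finset.sum_range_one, Nat.choose_self, Nat.cast_one, one_mul, pow_zero]
      rw [hzero]
      have := ih 0
      rw [pow_zero, one_mul] at this
      gcongr
    | succ m =>
      rw [Finset.sum_range_succ, Finset.sum_range_succ, Finset.sum_eq_zero, zero_add]
      · rw [Nat.sub_self, hzero, Nat.choose_self, show m + 1 - m = 1 by omega,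
          Nat.choose_succ_self_right, Nat.cast_one, one_mul]
        have h1 := ih m
        have h2 := ih (m + 1)
        have hb : (m + 1 : ℝ) * (n : ℝ) ^ m + (n : ℝ) ^ (m + 1) ≤ ((n : ℝ) + 1) ^ (m + 1) := by
          clear h1 h2
          induction m with
          | zero => simp [add_comm]
          | succ m ihm =>
            have h3 := mul_le_mul_of_nonneg_right ihm (by positivity : (0 : ℝ) ≤ n + 1)
            have h4 : (0 : ℝ) ≤ (m + 1) * (n : ℝ) ^ m := by positivity
            rw [pow_succ ((n : ℝ) + 1)]
            refine le_trans ?_ h3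
            push_cast
            rw [pow_succ (n : ℝ) (m + 1), pow_succ (n : ℝ) m]
            linarith
        calc _ ≤ ((m + 1 : ℕ) : ℝ) * ((L * n) ^ m * w) * (L * q) + (L * n) ^ (m + 1) * w * q := by
              gcongr
              exact hDL (v n)
          _ = L ^ (m + 1) * ((m + 1 : ℝ) * (n : ℝ) ^ m + (n : ℝ) ^ (m + 1)) * (w * q) := by
              push_cast; ring
          _ ≤ L ^ (m + 1) * ((n : ℝ) + 1) ^ (m + 1) * (w * q) := by gcongr
          _ = (L * (n + 1 : ℕ)) ^ (m + 1) * (w * q) := by rw [mul_pow]; push_cast; ring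
      · intro i hi
        rw [hhigh (v n) (m + 1 - i) (by have := Finset.mem_range.1 hi; omega)]
        simp

end Smoothness

/-! ### Increments of generalised Takagi functions -/

section Increments

open scoped ContDiff

variable {s : ℕ}

/-- The linear functional `∑ β_k ∂^k` on germs of functions at `p`. -/
def jetAt (p : Fin s → ℝ) (β : (Fin s → ℕ) →₀ ℝ) (F : (Fin s → ℝ) → ℝ) : ℝ :=
  β.sum fun k b => b * iteratedPartial k F p

theorem jetAt_sum {U : Set (Fin s → ℝ)} (hU : IsOpen U) {p : Fin s → ℝ} (hp : p ∈ U)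
    (β : (Fin s → ℕ) →₀ ℝ) {ι : Type*} {S : Finset ι} (c : ι → ℝ) {F : ι → (Fin s → ℝ) → ℝ}
    (hF : ∀ a, ContDiffOn ℝ ∞ (F a) U) {G : (Fin s → ℝ) → ℝ}
    (hG : EqOn G (fun u => ∑ a ∈ S, c a * F a u) U) :
    jetAt p β G = ∑ a ∈ S, c a * jetAt p β (F a) := by
  simp only [jetAt, Finsupp.sum, Finset.mul_sum]
  rw [Finset.sum_comm]
  refine Finset.sum_congr rfl fun k _ => ?_
  rw [iteratedPartial_sum hU c hF hG k hp, Finset.mul_sum]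
  exact Finset.sum_congr rfl fun a _ => by ring

theorem jetAt_add {U : Set (Fin s → ℝ)} (hU : IsOpen U) {p : Fin s → ℝ} (hp : p ∈ U)
    (β : (Fin s → ℕ) →₀ ℝ) (c₁ c₂ : ℝ) {F₁ F₂ G : (Fin s → ℝ) → ℝ} (h₁ : ContDiffOn ℝ ∞ F₁ U)
    (h₂ : ContDiffOn ℝ ∞ F₂ U) (hG : EqOn G (fun u => c₁ * F₁ u + c₂ * F₂ u) U) :
    jetAt p β G = c₁ * jetAt p β F₁ + c₂ * jetAt p β F₂ := by
  have := jetAt_sum hU hp β (S := Finset.univ) (fun b : Bool => if b then c₁ else c₂)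
    (F := fun b => if b then F₁ else F₂) (by intro b; cases b <;> simpa) (G := G)
    (by simpa using hG)
  simpa using this

theorem HasPolynomialJets.mul {U : Set (Fin s → ℝ)} (hU : IsOpen U) {p : Fin s → ℝ} (hp : p ∈ U)
    {Θ : Type*} {N : Θ → ℕ} {w : Θ → ℝ} (hw : ∀ t, 0 ≤ w t) {F G : Θ → (Fin s → ℝ) → ℝ}
    (hF : HasPolynomialJets N w p F) (hG : HasPolynomialJets N (fun _ => 1) p G)
    (hFs : ∀ t, ContDiffOn ℝ ∞ (F t) U) (hGs : ∀ t, ContDiffOn ℝ ∞ (G t) U) :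
    HasPolynomialJets N w p fun t u => F t u * G t u := by
  choose K₁ d₁ hK₁ h₁ using hF
  choose K₂ d₂ hK₂ h₂ using hG
  intro m
  refine ⟨∑ i ∈ Finset.range (m + 1), m.choose i * K₁ i * K₂ (m - i),
    ∑ i ∈ Finset.range (m + 1), (d₁ i + d₂ (m - i)),
    Finset.sum_nonneg fun i _ => by have := hK₁ i; have := hK₂ (m - i); positivity, fun t => ?_⟩
  have hleib := norm_iteratedFDerivWithin_mul_le (hFs t) (hGs t) hU.uniqueDiffOn hp (n := m)
    (by exact_mod_cast le_top)
  simp only [iteratedFDerivWithin_of_isOpen _ hU hp] at hleib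
  refine hleib.trans ?_
  rw [Finset.sum_mul, Finset.sum_mul]
  refine Finset.sum_le_sum fun i hi => ?_
  have hN : (1 : ℝ) ≤ N t + 1 := by linarith [(N t).cast_nonneg (α := ℝ)]
  have hK := mul_nonneg (hK₁ i) (hK₂ (m - i))
  calc _ ≤ m.choose i * (K₁ i * (N t + 1 : ℝ) ^ d₁ i * w t) *
        (K₂ (m - i) * (N t + 1 : ℝ) ^ d₂ (m - i) * 1) := by
        have hpos : 0 ≤ K₁ i * (N t + 1 : ℝ) ^ d₁ i * w t :=
          mul_nonneg (mul_nonneg (hK₁ i) (by positivity)) (hw t)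
        gcongr
        · exact h₁ i t
        · exact h₂ (m - i) t
    _ = m.choose i * K₁ i * K₂ (m - i) * (N t + 1 : ℝ) ^ (d₁ i + d₂ (m - i)) * w t := by
        rw [pow_add]; ring
    _ ≤ _ := by
        have hc : 0 ≤ m.choose i * K₁ i * K₂ (m - i) := by rw [mul_assoc]; positivity
        refine mul_le_mul_of_nonneg_right (mul_le_mul_of_nonneg_left ?_ hc) (hw t)
        exact pow_le_pow_right₀ hN
          (Finset.single_le_sum (f := fun i => d₁ i + d₂ (m - i)) (fun _ _ => Nat.zero_le _) hi)

theorem HasPolynomialJets.exists_abs_jetAt_le {U : Set (Fin s → ℝ)} (hU : IsOpen U)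
    {p : Fin s → ℝ} (hp : p ∈ U) {Θ : Type*} {N : Θ → ℕ} {w : Θ → ℝ} (hw : ∀ t, 0 ≤ w t)
    {F : Θ → (Fin s → ℝ) → ℝ} (hF : HasPolynomialJets N w p F)
    (hFs : ∀ t, ContDiffOn ℝ ∞ (F t) U) (β : (Fin s → ℕ) →₀ ℝ) :
    ∃ K : ℝ, ∃ d : ℕ, 0 ≤ K ∧ ∀ t, |jetAt p β (F t)| ≤ K * (N t + 1 : ℝ) ^ d * w t := by
  choose K d hK h using fun k => hF.iteratedPartial hU hp hFs k 0
  refine ⟨∑ k ∈ β.support, |β k| * K k, ∑ k ∈ β.support, d k,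
    Finset.sum_nonneg fun k _ => mul_nonneg (abs_nonneg _) (hK k), fun t => ?_⟩
  have hN : (1 : ℝ) ≤ N t + 1 := by linarith [(N t).cast_nonneg (α := ℝ)]
  rw [Finset.sum_mul, Finset.sum_mul]
  refine (Finset.abs_sum_le_sum_abs _ _).trans (Finset.sum_le_sum fun k hk => ?_)
  have h1 := h k t
  rw [norm_iteratedFDeriv_zero, Real.norm_eq_abs] at h1
  rw [abs_mul, mul_assoc, mul_assoc]
  refine mul_le_mul_of_nonneg_left (h1.trans ?_) (abs_nonneg _)
  rw [mul_assoc]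
  refine mul_le_mul_of_nonneg_left (mul_le_mul_of_nonneg_right ?_ (hw t)) (hK k)
  exact pow_le_pow_right₀ hN (Finset.single_le_sum (f := d) (fun _ _ => Nat.zero_le _) hk)

/-- For `k` maximal in the support of `β`, multiplication by `(u - p)^k` isolates the term of
index `k`. -/
theorem exists_jetAt_prod_pow_mul {U : Set (Fin s → ℝ)} (hU : IsOpen U) {p : Fin s → ℝ}
    (hp : p ∈ U) {β : (Fin s → ℕ) →₀ ℝ} (hβ : β ≠ 0) : ∃ k : Fin s → ℕ, ∃ c : ℝ, c ≠ 0 ∧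
      ∀ H : (Fin s → ℝ) → ℝ, ContDiffOn ℝ ∞ H U →
        jetAt p β (fun u => (∏ i, (u i - p i) ^ k i) * H u) = c * H p := by
  obtain ⟨k, hk⟩ := β.support.exists_maximal (Finsupp.support_nonempty_iff.2 hβ)
  have hkne : β k ≠ 0 := Finsupp.mem_support_iff.1 hk.prop
  refine ⟨k, β k * ∏ i, ((k i).factorial : ℝ), mul_ne_zero hkne
    (Finset.prod_ne_zero_iff.2 fun i _ => Nat.cast_ne_zero.2 (Nat.factorial_ne_zero _)),
    fun H hH => ?_⟩
  rw [jetAt, Finsupp.sum, Finset.sum_eq_single k]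
  · rw [iteratedPartial_prod_pow_mul hU hp k hH]; ring
  · intro j hj hjk
    have hlt : ∃ i, j i < k i := by
      by_contra! hle
      exact hjk ((hk.eq_of_le hj hle).symm)
    obtain ⟨i, hi⟩ := hlt
    have hsplit : (fun u : Fin s → ℝ => (∏ i, (u i - p i) ^ k i) * H u) = fun u =>
        (u i - p i) ^ k i * ((∏ i ∈ Finset.univ.erase i, (u i - p i) ^ k i) * H u) := by
      funext u
      rw [← Finset.mul_prod_erase _ _ (Finset.mem_univ i), mul_assoc]
    rw [hsplit, iteratedPartial_pow_mul_eq_zero hU hp hi, mul_zero]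
    exact (contDiff_prod fun i _ => by fun_prop).contDiffOn.mul hH
  · exact fun h => absurd hk.prop h

variable {f : Fin (s + 1) → ℝ → ℝ} {a b η l : ℝ}

theorem IsSeparatedSystem.jetAt_sub (h : IsSeparatedSystem f a b η l) (hs : 1 ≤ s)
    {p : Fin s → ℝ} (hp : p ∈ paramSet s) (β : (Fin s → ℕ) →₀ ℝ) {x y : ℝ}
    {G : (Fin s → ℝ) → ℝ}
    (hG : ∀ u ∈ paramSet s, probInfty f u y - probInfty f u x = G u) :
    jetAt p β (fun u => probInfty f u y) - jetAt p β (fun u => probInfty f u x) =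
      jetAt p β G := by
  rw [jetAt_add (isOpen_paramSet s) hp β 1 (-1) (h.contDiffOn_probInfty hs y)
    (h.contDiffOn_probInfty hs x) (G := G) fun u hu => by rw [← hG u hu]; ring]
  ring

/-- Two points of one cylinder of level `n`: the increment of a generalised Takagi function is
at most a polynomial in `n` times the weight of the cylinder. -/
theorem IsSeparatedSystem.exists_abs_increment_le (h : IsSeparatedSystem f a b η l) (hs : 1 ≤ s)
    {p : Fin s → ℝ} (hp : p ∈ paramSet s) (β : (Fin s → ℕ) →₀ ℝ) :
    ∃ K : ℝ, ∃ d : ℕ, 0 ≤ K ∧ ∀ (v : ℕ → Fin (s + 1)) (n : ℕ) (x y : ℝ),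
      realOrbit f v n x ∈ Icc (a - η) (b + η) → realOrbit f v n y ∈ Icc (a - η) (b + η) →
      |jetAt p β (fun u => probInfty f u y) - jetAt p β (fun u => probInfty f u x)| ≤
        K * (n + 1 : ℝ) ^ d * ∏ j ∈ Finset.range n, probVec p (v j) := by
  have hU := isOpen_paramSet s
  let Θ := (ℕ → Fin (s + 1)) × ℕ × ℝ × ℝ
  let N : Θ → ℕ := fun t => t.2.1
  let w : Θ → ℝ := fun t => ∏ j ∈ Finset.range t.2.1, probVec p (t.1 j)
  have hw : ∀ t, 0 ≤ w t := fun t => Finset.prod_nonneg fun j _ => (probVec_pos hp _).le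
  let F : Θ → (Fin s → ℝ) → ℝ := fun t u => ∏ j ∈ Finset.range t.2.1, probVec u (t.1 j)
  let G : Θ → (Fin s → ℝ) → ℝ := fun t u => probInfty f u t.2.2.2 - probInfty f u t.2.2.1
  have hFs : ∀ t, ContDiffOn ℝ ∞ (F t) (paramSet s) := fun t =>
    (contDiff_prod_probVec _ _).contDiffOn
  have hGs : ∀ t, ContDiffOn ℝ ∞ (G t) (paramSet s) := fun t =>
    (h.contDiffOn_probInfty hs _).sub (h.contDiffOn_probInfty hs _)
  have hF : HasPolynomialJets N w p F := by
    obtain ⟨L, hL, hb⟩ := exists_norm_iteratedFDeriv_prod_le hp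
    refine fun m => ⟨L ^ m, m, pow_nonneg hL m, fun t => (hb t.1 t.2.1 m).trans ?_⟩
    rw [mul_pow]
    refine mul_le_mul_of_nonneg_right ?_ (hw t)
    have : (N t : ℝ) ≤ N t + 1 := by linarith
    gcongr
  have hG : HasPolynomialJets N (fun _ => 1) p G := by
    intro m
    obtain ⟨K, hK, hb⟩ := h.exists_norm_iteratedFDeriv_le hs hp m
    exact ⟨K, 0, hK, fun t => by simpa using hb t.2.2.1 t.2.2.2⟩
  obtain ⟨K, d, hK, hb⟩ := (hF.mul hU hp hw hG hFs hGs).exists_abs_jetAt_le hU hp hw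
    (fun t => (hFs t).mul (hGs t)) β
  refine ⟨K, d, hK, fun v n x y hx hy => ?_⟩
  rw [h.jetAt_sub hs hp β fun u hu => h.probInfty_sub_eq_prod_mul hu v n hx hy]
  exact hb (v, n, realOrbit f v n x, realOrbit f v n y)

/-- The polynomials in `u` are spanned by the weights of words. -/
theorem prod_pow_mem_span_words (p : Fin s → ℝ) (k : Fin s → ℕ) :
    (fun u : Fin s → ℝ => ∏ i, (u i - p i) ^ k i) ∈ Submodule.span ℝ
      (range fun (τ : List (Fin (s + 1))) (u : Fin s → ℝ) => (τ.map (probVec u)).prod) := by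
  set A : Subalgebra ℝ ((Fin s → ℝ) → ℝ) :=
    Algebra.adjoin ℝ (range fun (i : Fin (s + 1)) (u : Fin s → ℝ) => probVec u i) with hA
  have hmem : (fun u : Fin s → ℝ => ∏ i, (u i - p i) ^ k i) ∈ A := by
    have : (fun u : Fin s → ℝ => ∏ i, (u i - p i) ^ k i) = ∏ i, ((fun u : Fin s → ℝ =>
        probVec u i.castSucc) - algebraMap ℝ ((Fin s → ℝ) → ℝ) (p i)) ^ k i := by
      funext u
      simp [Finset.prod_apply, probVec, Fin.snoc_castSucc, Pi.algebraMap_apply]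
    rw [this]
    have hg : ∀ i, (fun u : Fin s → ℝ => probVec u i) ∈ A := fun i =>
      Algebra.subset_adjoin (mem_range_self i)
    exact prod_mem fun i _ => pow_mem (sub_mem (hg i.castSucc) (A.algebraMap_mem _)) _
  rw [← Subalgebra.mem_toSubmodule, hA, Algebra.adjoin_eq_span] at hmem
  refine Submodule.span_mono ?_ hmem
  intro g hg
  obtain ⟨L, hL, rfl⟩ := Submonoid.exists_list_of_mem_closure hg
  clear hg hmem
  induction L with
  | nil => exact ⟨[], by funext u; simp⟩
  | cons g L ih =>
    obtain ⟨τ, hτ⟩ := ih fun y hy => hL y (List.mem_cons_of_mem _ hy)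
    obtain ⟨i, rfl⟩ := hL g (by simp)
    exact ⟨i :: τ, by funext u; rw [List.prod_cons, ← hτ]; simp⟩

/-- Within a cylinder of level `n`, a non-trivial generalised Takagi function oscillates by at
least a constant times the weight of the cylinder: the increments over sub-cylinders realise
`u_{ω|n}` times any word, hence also `u_{ω|n}` times `(u - p)^k`. -/
theorem IsSeparatedSystem.exists_increment_ge (h : IsSeparatedSystem f a b η l) (hs : 1 ≤ s)
    {p : Fin s → ℝ} (hp : p ∈ paramSet s) {β : (Fin s → ℕ) →₀ ℝ} (hβ : β ≠ 0) :
    ∃ c : ℝ, 0 < c ∧ ∀ (v : ℕ → Fin (s + 1)) (n : ℕ) (x : ℝ),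
      ∃ y, realOrbit f v n y ∈ Icc (a - η) (b + η) ∧
      c * ∏ j ∈ Finset.range n, probVec p (v j) ≤
        |jetAt p β (fun u => probInfty f u y) - jetAt p β (fun u => probInfty f u x)| := by
  have hU := isOpen_paramSet s
  obtain ⟨k, c, hc, hjet⟩ := exists_jetAt_prod_pow_mul hU hp hβ
  have hsmw : ∀ (v : ℕ → Fin (s + 1)) (n : ℕ), ContDiffOn ℝ ∞
      (fun u : Fin s → ℝ => ∏ j ∈ Finset.range n, probVec u (v j)) (paramSet s) := fun v n =>
    (contDiff_prod_probVec v n).contDiffOn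
  -- Bounds for all words pass to the functions spanned by the words.
  let P : ((Fin s → ℝ) → ℝ) → Prop := fun G => ContDiffOn ℝ ∞ G (paramSet s) ∧ ∃ K, 0 ≤ K ∧
    ∀ (v : ℕ → Fin (s + 1)) (n : ℕ) (M : ℝ),
      (∀ τ : List (Fin (s + 1)), |jetAt p β fun u => (∏ j ∈ Finset.range n, probVec u (v j)) *
        (τ.map (probVec u)).prod| ≤ M) →
      |jetAt p β fun u => (∏ j ∈ Finset.range n, probVec u (v j)) * G u| ≤ K * M
  have hP : P fun u => ∏ i, (u i - p i) ^ k i := by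
    refine Submodule.span_induction (p := fun G _ => P G) ?_ ?_ ?_ ?_
      (prod_pow_mem_span_words p k)
    · rintro _ ⟨τ, rfl⟩
      refine ⟨ContDiff.contDiffOn ?_, 1, zero_le_one, fun v n M hM => by simpa using hM τ⟩
      induction τ with
      | nil => simpa using contDiff_const
      | cons i τ ih => simpa using (contDiff_probVec i).mul ih
    · refine ⟨contDiffOn_const, 0, le_rfl, fun v n M _ => ?_⟩
      rw [jetAt_add hU hp β 0 0 (hsmw v n) (hsmw v n) fun u _ => by simp]
      simp
    · rintro G₁ G₂ - - ⟨hs₁, K₁, hK₁, hb₁⟩ ⟨hs₂, K₂, hK₂, hb₂⟩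
      refine ⟨hs₁.add hs₂, K₁ + K₂, add_nonneg hK₁ hK₂, fun v n M hM => ?_⟩
      rw [jetAt_add hU hp β 1 1 ((hsmw v n).mul hs₁) ((hsmw v n).mul hs₂)
        fun u _ => by simp only [Pi.add_apply]; ring]
      rw [one_mul, one_mul, add_mul]
      exact (abs_add_le _ _).trans (add_le_add (hb₁ v n M hM) (hb₂ v n M hM))
    · rintro r G - ⟨hs₁, K, hK, hb⟩
      refine ⟨contDiffOn_const.smul hs₁, |r| * K, by positivity, fun v n M hM => ?_⟩
      rw [jetAt_add hU hp β r 0 ((hsmw v n).mul hs₁) (hsmw v n)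
        fun u _ => by simp only [Pi.smul_apply, smul_eq_mul]; ring]
      rw [zero_mul, add_zero, abs_mul, mul_assoc]
      exact mul_le_mul_of_nonneg_left (hb v n M hM) (abs_nonneg r)
  obtain ⟨-, K, hK, hb⟩ := hP
  refine ⟨|c| / (2 * K + 1) / 2, by positivity, fun v n x => ?_⟩
  by_contra! hcon
  set w := ∏ j ∈ Finset.range n, probVec p (v j) with hw
  have hw0 : 0 < w := Finset.prod_pos fun j _ => probVec_pos hp _
  have h1 := hb v n (|c| / (2 * K + 1) * w) fun τ => by
    obtain ⟨z₁, hz₁, z₂, hz₂, hz⟩ := h.exists_probInfty_sub_eq_word τ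
    obtain ⟨y₁, rfl⟩ := h.realOrbit_surjective v n z₁
    obtain ⟨y₂, rfl⟩ := h.realOrbit_surjective v n z₂
    rw [← h.jetAt_sub hs hp β (x := y₁) (y := y₂) fun u hu => by
      rw [h.probInfty_sub_eq_prod_mul hu v n hz₁ hz₂, hz u hu]]
    have e₁ := abs_lt.1 (hcon y₁ hz₁)
    have e₂ := abs_lt.1 (hcon y₂ hz₂)
    rw [abs_le]
    constructor <;> linarith [e₁.1, e₁.2, e₂.1, e₂.2]
  have h2 : (fun u : Fin s → ℝ => (∏ j ∈ Finset.range n, probVec u (v j)) *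
      ∏ i, (u i - p i) ^ k i) = fun u => (∏ i, (u i - p i) ^ k i) *
      ∏ j ∈ Finset.range n, probVec u (v j) := by
    funext u; ring
  rw [h2, hjet _ (hsmw v n), abs_mul, ← hw, abs_of_pos hw0] at h1
  have hcpos : 0 < |c| * w := mul_pos (abs_pos.2 hc) hw0
  have h3 : K * (|c| / (2 * K + 1) * w) = K / (2 * K + 1) * (|c| * w) := by ring
  have h4 : K / (2 * K + 1) < 1 := by rw [div_lt_one (by positivity)]; linarith
  rw [h3] at h1
  nlinarith

end Increments

/-! ### Bounded distortion -/

section Distortion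

variable {s : ℕ} {f : Fin (s + 1) → ℝ → ℝ} {a b η l : ℝ}

/-- The derivative of `f_{ω|n}` at `x`. -/
def orbitDeriv (f : Fin (s + 1) → ℝ → ℝ) (ω : ℕ → Fin (s + 1)) (n : ℕ) (x : ℝ) : ℝ :=
  ∏ k ∈ Finset.range n, deriv (f (ω k)) (realOrbit f ω k x)

theorem orbitDeriv_succ_left (f : Fin (s + 1) → ℝ → ℝ) (ω : ℕ → Fin (s + 1)) (n : ℕ) (x : ℝ) :
    orbitDeriv f ω (n + 1) x = deriv (f (ω 0)) x * orbitDeriv f (shift ω) n (f (ω 0) x) := by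
  rw [orbitDeriv, Finset.prod_range_succ', mul_comm]
  simp only [realOrbit_succ_left]
  rfl

theorem pow_le_orbitDeriv (hl : 0 ≤ l) (hderiv : ∀ i x, l ≤ deriv (f i) x)
    (ω : ℕ → Fin (s + 1)) (n : ℕ) (x : ℝ) : l ^ n ≤ orbitDeriv f ω n x := by
  have := Finset.prod_le_prod (s := Finset.range n) (f := fun _ => l)
    (g := fun k => deriv (f (ω k)) (realOrbit f ω k x)) (fun _ _ => hl) fun _ _ => hderiv _ _
  simpa [orbitDeriv] using this

theorem exists_sub_eq_deriv_mul {g : ℝ → ℝ} (hg : Differentiable ℝ g) (x y : ℝ) :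
    ∃ ξ, |ξ - x| ≤ |y - x| ∧ g y - g x = deriv g ξ * (y - x) := by
  rcases lt_trichotomy x y with hxy | rfl | hxy
  · obtain ⟨ξ, hξ, he⟩ := exists_deriv_eq_slope g hxy hg.continuous.continuousOn
      hg.differentiableOn
    refine ⟨ξ, ?_, ?_⟩
    · rw [abs_of_pos (sub_pos.2 hξ.1), abs_of_pos (sub_pos.2 hxy)]; linarith [hξ.2]
    · rw [he, div_mul_cancel₀ _ (sub_pos.2 hxy).ne']
  · exact ⟨x, le_rfl, by simp⟩
  · obtain ⟨ξ, hξ, he⟩ := exists_deriv_eq_slope g hxy hg.continuous.continuousOn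
      hg.differentiableOn
    refine ⟨ξ, ?_, ?_⟩
    · rw [abs_of_neg (sub_neg.2 hξ.2), abs_of_neg (sub_neg.2 hxy)]; linarith [hξ.1]
    · have : x - y ≠ 0 := (sub_pos.2 hxy).ne'
      rw [he]; field_simp; ring

/-- Bounded distortion: as long as two orbits along `ω` stay within distance `R`, their distance
is comparable to the initial distance times the derivative. The logarithmic error of the step
with `m` steps to go is a multiple of `(R / l ^ m) ^ ε`, by the Hölder condition, and these
errors form a geometric series. -/
theorem exists_distortion (h : IsSeparatedSystem f a b η l) (hdiff : IsDiffeoFamily f)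
    (hderiv : ∀ i x, l ≤ deriv (f i) x) {R : ℝ} (hR : 0 ≤ R) :
    ∃ c : ℝ, 0 < c ∧ ∀ (n : ℕ) (ω : ℕ → Fin (s + 1)) (x y : ℝ),
      |realOrbit f ω n y - realOrbit f ω n x| ≤ R →
      |realOrbit f ω n y - realOrbit f ω n x| ≤ c * (orbitDeriv f ω n x * |y - x|) ∧
      orbitDeriv f ω n x * |y - x| ≤ c * |realOrbit f ω n y - realOrbit f ω n x| := by
  have hl1 := h.one_lt
  have hl0 : 0 < l := by linarith
  have hd : ∀ i, Differentiable ℝ (f i) := fun i => (hdiff.1 i).1.differentiable one_ne_zero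
  obtain ⟨ε, hε, hH⟩ := hdiff.2
  choose K₀ hK₀ using hH
  set K : ℝ := ∑ i, (K₀ i : ℝ) with hK
  have hK0 : 0 ≤ K := Finset.sum_nonneg fun i _ => (K₀ i).2
  have hHol : ∀ i x y, |deriv (f i) x - deriv (f i) y| ≤ K * |x - y| ^ (ε : ℝ) := fun i x y => by
    refine ((hK₀ i).dist_le x y).trans ?_
    rw [Real.dist_eq]
    refine mul_le_mul_of_nonneg_right ?_ (by positivity)
    exact Finset.single_le_sum (f := fun i => (K₀ i : ℝ)) (fun j _ => (K₀ j).2)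
      (Finset.mem_univ i)
  have hstep : ∀ i x y r, K * |y - x| ^ (ε : ℝ) ≤ r →
      |f i y - f i x| ≤ Real.exp r * (deriv (f i) x * |y - x|) ∧
      deriv (f i) x * |y - x| ≤ Real.exp r * |f i y - f i x| := by
    intro i x y r hr
    obtain ⟨ξ, hξ, he⟩ := exists_sub_eq_deriv_mul (hd i) x y
    have h1 : |deriv (f i) ξ - deriv (f i) x| ≤ r := (hHol i ξ x).trans
      (le_trans (by gcongr) hr)
    have hx := hderiv i x
    have hξ1 := hderiv i ξ
    have hexp : 1 + r ≤ Real.exp r := by linarith [Real.add_one_le_exp r]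
    have hr0 : 0 ≤ r := (abs_nonneg _).trans h1
    obtain ⟨h1a, h1b⟩ := abs_le.1 h1
    rw [he, abs_mul, abs_of_pos (by linarith : 0 < deriv (f i) ξ), ← mul_assoc, ← mul_assoc]
    constructor
    · refine mul_le_mul_of_nonneg_right ?_ (abs_nonneg _)
      have : deriv (f i) ξ ≤ (1 + r) * deriv (f i) x := by nlinarith
      exact this.trans (mul_le_mul_of_nonneg_right hexp (by linarith))
    · refine mul_le_mul_of_nonneg_right ?_ (abs_nonneg _)
      have : deriv (f i) x ≤ (1 + r) * deriv (f i) ξ := by nlinarith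
      exact this.trans (mul_le_mul_of_nonneg_right hexp (by linarith))
  set θ : ℝ := (l ^ (ε : ℝ))⁻¹ with hθ
  have hlε : 1 < l ^ (ε : ℝ) := Real.one_lt_rpow hl1 (by exact_mod_cast hε)
  have hθ0 : 0 ≤ θ := inv_nonneg.2 (by linarith)
  have hθ1 : θ < 1 := inv_lt_one_of_one_lt₀ hlε
  set M : ℝ := K * R ^ (ε : ℝ) with hM
  have hM0 : 0 ≤ M := mul_nonneg hK0 (Real.rpow_nonneg hR _)
  have main : ∀ (n : ℕ) (ω : ℕ → Fin (s + 1)) (x y : ℝ),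
      |realOrbit f ω n y - realOrbit f ω n x| ≤ R →
      |realOrbit f ω n y - realOrbit f ω n x| ≤
        Real.exp (M * ∑ j ∈ Finset.range (n + 1), θ ^ j) * (orbitDeriv f ω n x * |y - x|) ∧
      orbitDeriv f ω n x * |y - x| ≤ Real.exp (M * ∑ j ∈ Finset.range (n + 1), θ ^ j) *
        |realOrbit f ω n y - realOrbit f ω n x| := by
    intro n
    induction n with
    | zero =>
      intro ω x y _
      simp only [realOrbit, orbitDeriv, Finset.range_zero, Finset.prod_empty, one_mul]
      have : 1 ≤ Real.exp (M * ∑ j ∈ Finset.range (0 + 1), θ ^ j) :=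
        Real.one_le_exp (mul_nonneg hM0 (Finset.sum_nonneg fun j _ => pow_nonneg hθ0 j))
      exact ⟨le_mul_of_one_le_left (abs_nonneg _) this,
        le_mul_of_one_le_left (abs_nonneg _) this⟩
    | succ n ih =>
      intro ω x y hxy
      have hexpd := (h.abs_realOrbit_expand ω (n + 1) x y).trans hxy
      have hsmall : |y - x| ≤ R / l ^ (n + 1) := by
        rw [le_div_iff₀ (by positivity)]; linarith
      have hr : K * |y - x| ^ (ε : ℝ) ≤ M * θ ^ (n + 1) := by
        rw [hM, mul_assoc]
        refine mul_le_mul_of_nonneg_left ?_ hK0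
        refine (Real.rpow_le_rpow (abs_nonneg _) hsmall ε.2).trans (le_of_eq ?_)
        rw [Real.div_rpow hR (by positivity), hθ, inv_pow, Real.rpow_pow_comm hl0.le,
          div_eq_mul_inv]
        rfl
      obtain ⟨s1, s2⟩ := hstep (ω 0) x y _ hr
      rw [realOrbit_succ_left, realOrbit_succ_left] at hxy ⊢
      obtain ⟨i1, i2⟩ := ih (shift ω) (f (ω 0) x) (f (ω 0) y) hxy
      rw [orbitDeriv_succ_left, Finset.sum_range_succ, mul_add, Real.exp_add]
      set E := Real.exp (M * ∑ j ∈ Finset.range (n + 1), θ ^ j)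
      set e := Real.exp (M * θ ^ (n + 1))
      have hE : 0 < E := Real.exp_pos _
      have he : 0 < e := Real.exp_pos _
      have hD : 0 ≤ orbitDeriv f (shift ω) n (f (ω 0) x) :=
        (pow_nonneg hl0.le n).trans (pow_le_orbitDeriv hl0.le hderiv _ _ _)
      constructor
      · refine i1.trans ?_
        calc _ ≤ E * (orbitDeriv f (shift ω) n (f (ω 0) x) *
              (e * (deriv (f (ω 0)) x * |y - x|))) := by gcongr
          _ = _ := by ring
      · calc _ = orbitDeriv f (shift ω) n (f (ω 0) x) * (deriv (f (ω 0)) x * |y - x|) := by ring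
          _ ≤ orbitDeriv f (shift ω) n (f (ω 0) x) * (e * |f (ω 0) y - f (ω 0) x|) := by gcongr
          _ = e * (orbitDeriv f (shift ω) n (f (ω 0) x) * |f (ω 0) y - f (ω 0) x|) := by ring
          _ ≤ e * (E * _) := by gcongr
          _ = _ := by ring
  refine ⟨Real.exp (M * (1 - θ)⁻¹), Real.exp_pos _, fun n ω x y hxy => ?_⟩
  obtain ⟨m1, m2⟩ := main n ω x y hxy
  have hle : Real.exp (M * ∑ j ∈ Finset.range (n + 1), θ ^ j) ≤ Real.exp (M * (1 - θ)⁻¹) := by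
    refine Real.exp_le_exp.2 (mul_le_mul_of_nonneg_left ?_ hM0)
    rw [← tsum_geometric_of_lt_one hθ0 hθ1]
    exact (summable_geometric_of_lt_one hθ0 hθ1).sum_le_tsum _ fun j _ => pow_nonneg hθ0 j
  have hD : 0 ≤ orbitDeriv f ω n x :=
    (pow_nonneg hl0.le n).trans (pow_le_orbitDeriv hl0.le hderiv _ _ _)
  exact ⟨m1.trans (mul_le_mul_of_nonneg_right hle (by positivity)),
    m2.trans (mul_le_mul_of_nonneg_right hle (abs_nonneg _))⟩

/-- A point `y` near `x` leaves the enlarged interval for the first time at some step `n + 1`. At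
that step it is at distance at least `η` from the orbit of `x`, so that `|y - x|` is at least a
constant times the inverse of the derivative of `f_{ω|n}`; the closer `y` is to `x`, the larger
is `n`. -/
theorem exists_exit_time (h : IsSeparatedSystem f a b η l) (hdiff : IsDiffeoFamily f)
    (hderiv : ∀ i x, l ≤ deriv (f i) x) :
    ∃ c : ℝ, 0 < c ∧ ∀ (ω : ℕ → Fin (s + 1)) (x : ℝ), (∀ n, realOrbit f ω n x ∈ Icc a b) →
      ∀ N : ℕ, ∃ δ : ℝ, 0 < δ ∧ ∀ y, y ≠ x → |y - x| < δ → ∃ n, N ≤ n ∧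
        realOrbit f ω n y ∈ Icc (a - η) (b + η) ∧ c ≤ orbitDeriv f ω n x * |y - x| := by
  have hl1 := h.one_lt
  have hη := h.room
  have hab := h.lt
  obtain ⟨c, hc, hdist⟩ := exists_distortion h hdiff hderiv (R := b - a + 2 * η) (by linarith)
  obtain ⟨Λ, hΛ⟩ : ∃ Λ : ℝ, ∀ i, ∀ z ∈ Icc (a - η) (b + η), deriv (f i) z ≤ Λ := by
    have : ∀ i, ∃ Λ : ℝ, ∀ z ∈ Icc (a - η) (b + η), deriv (f i) z ≤ Λ := fun i => by
      obtain ⟨Λ, hΛ⟩ := (isCompact_Icc (a := a - η) (b := b + η)).bddAbove_image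
        ((hdiff.1 i).1.continuous_deriv le_rfl).continuousOn
      exact ⟨Λ, fun z hz => hΛ ⟨z, hz, rfl⟩⟩
    choose Λ hΛ using this
    obtain ⟨i₀, hi₀⟩ := Finite.exists_max Λ
    exact ⟨Λ i₀, fun i z hz => (hΛ i z hz).trans (hi₀ i)⟩
  have hΛ1 : 1 < Λ := hl1.trans_le ((hderiv 0 a).trans (hΛ 0 a ⟨by linarith, by linarith⟩))
  have hd : ∀ i, Differentiable ℝ (f i) := fun i => (hdiff.1 i).1.differentiable one_ne_zero
  have hlip : ∀ i, ∀ z ∈ Icc (a - η) (b + η), ∀ w ∈ Icc (a - η) (b + η),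
      |f i w - f i z| ≤ Λ * |w - z| := fun i z hz w hw => by
    refine (convex_Icc (a - η) (b + η)).norm_image_sub_le_of_norm_deriv_le
      (fun v _ => hd i v) (fun v hv => ?_) hz hw
    rw [Real.norm_eq_abs, abs_of_pos (by linarith [hderiv i v])]
    exact hΛ i v hv
  refine ⟨η / (Λ * c), by positivity, fun ω x hx N => ?_⟩
  have hxJ : ∀ n, realOrbit f ω n x ∈ Icc (a - η) (b + η) := fun n =>
    ⟨by linarith [(hx n).1], by linarith [(hx n).2]⟩
  -- Up to time `N`, the orbit of a close point stays within the margin `η`.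
  have hclose : ∀ᶠ y in 𝓝 x, realOrbit f ω N y ∈ Icc (a - η) (b + η) :=
    (h.realOrbit_continuous ω N).continuousAt.eventually_mem
      (Icc_mem_nhds (by linarith [(hx N).1]) (by linarith [(hx N).2]))
  obtain ⟨δ, hδ, hball⟩ := Metric.eventually_nhds_iff.1 hclose
  refine ⟨δ, hδ, fun y hyx hy => ?_⟩
  have hyN := hball (by rwa [Real.dist_eq])
  have hexit : ∃ n, realOrbit f ω n y ∉ Icc (a - η) (b + η) := by
    have ht : Tendsto (fun n : ℕ => l ^ n * |y - x|) atTop atTop :=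
      (tendsto_pow_atTop_atTop_of_one_lt hl1).atTop_mul_const (abs_pos.2 (sub_ne_zero.2 hyx))
    obtain ⟨n, hn⟩ := (ht.eventually_gt_atTop (b - a + 2 * η)).exists
    refine ⟨n, fun hmem => ?_⟩
    have h1 := h.abs_realOrbit_expand ω n x y
    have h2 := abs_sub_le_of_le_of_le hmem.1 hmem.2 (hxJ n).1 (hxJ n).2
    linarith
  classical
  have hNlt : N < Nat.find hexit := by
    by_contra hle
    exact Nat.find_spec hexit (h.mem_of_realOrbit_mem hη.le (not_lt.1 hle) hyN)
  obtain ⟨n, hn⟩ := Nat.exists_eq_add_of_lt hNlt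
  have hin : realOrbit f ω (N + n) y ∈ Icc (a - η) (b + η) := by
    by_contra hcon
    have := Nat.find_min' hexit hcon
    omega
  have hout : realOrbit f ω (N + n + 1) y ∉ Icc (a - η) (b + η) := hn ▸ Nat.find_spec hexit
  refine ⟨N + n, Nat.le_add_right N n, hin, ?_⟩
  have hfar : η ≤ |realOrbit f ω (N + n + 1) y - realOrbit f ω (N + n + 1) x| := by
    simp only [mem_Icc, not_and_or, not_le] at hout
    have hx1 := hx (N + n + 1)
    rcases hout with ho | ho
    · exact le_abs.2 (Or.inr (by linarith [hx1.1]))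
    · exact le_abs.2 (Or.inl (by linarith [hx1.2]))
  have h1 := hlip (ω (N + n)) _ (hxJ (N + n)) _ hin
  have h2 := (hdist (N + n) ω x y
    ((abs_sub_le_of_le_of_le hin.1 hin.2 (hxJ _).1 (hxJ _).2).trans (by linarith))).1
  rw [div_le_iff₀ (by positivity)]
  calc η ≤ Λ * |realOrbit f ω (N + n) y - realOrbit f ω (N + n) x| := hfar.trans h1
    _ ≤ Λ * (c * (orbitDeriv f ω (N + n) x * |y - x|)) := by gcongr
    _ = _ := by ring

end Distortion

/-! ### Pointwise Hölder exponents from estimates at geometric scales -/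

section HolderExponent

theorem le_holderExponent {C : EReal → ℝ} {x α B : ℝ} (hα : 0 < α)
    (hB : ∀ᶠ y : ℝ in 𝓝[≠] x, |C (y : EReal) - C (x : EReal)| / |y - x| ^ α ≤ B) :
    ENNReal.ofReal α ≤ holderExponent C x := by
  have hlim : limsup (fun y : ℝ =>
      ENNReal.ofReal (|C (y : EReal) - C (x : EReal)| / |y - x| ^ α)) (𝓝[≠] x) < ⊤ :=
    (limsup_le_of_le (h := hB.mono fun y hy => ENNReal.ofReal_le_ofReal hy)).trans_lt
      ENNReal.ofReal_lt_top
  unfold holderExponent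
  exact le_iSup_of_le α (le_iSup_of_le hα (le_iSup_of_le hlim le_rfl))

theorem exists_of_lt_holderExponent {C : EReal → ℝ} {x : ℝ} {r : ℝ≥0∞}
    (hr : r < holderExponent C x) : ∃ α : ℝ, 0 < α ∧ r < ENNReal.ofReal α ∧
      ∃ B : ℝ, ∀ᶠ y : ℝ in 𝓝[≠] x, |C (y : EReal) - C (x : EReal)| / |y - x| ^ α ≤ B := by
  unfold holderExponent at hr
  simp only [lt_iSup_iff] at hr
  obtain ⟨α, hα, hlim, hr⟩ := hr
  obtain ⟨M, hM, hMtop⟩ := exists_between hlim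
  refine ⟨α, hα, hr, M.toReal, (eventually_lt_of_limsup_lt hM).mono fun y hy => ?_⟩
  exact (ENNReal.ofReal_le_iff_le_toReal hMtop.ne).1 hy.le

/-- If the increments of `C` near `x` at the scales `1 / D n` are at most `P n` up to polynomial
factors, and infinitely often comparable to `P n`, then the Hölder exponent at `x` is the lower
limit of `log (P n) / log (1 / D n)`. -/
theorem holderExponent_eq_liminf {C : EReal → ℝ} {x l : ℝ} (hl : 1 < l) {D P : ℕ → ℝ}
    (hD : ∀ n, l ^ n ≤ D n) (hP : ∀ n, 0 < P n) (hP1 : ∀ n, P n ≤ 1) {K c : ℝ} {d : ℕ}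
    (hK : 0 ≤ K) (hc : 0 < c)
    (hupper : ∀ N : ℕ, ∃ δ : ℝ, 0 < δ ∧ ∀ y : ℝ, y ≠ x → |y - x| < δ → ∃ n, N ≤ n ∧
      c ≤ D n * |y - x| ∧ |C (y : EReal) - C (x : EReal)| ≤ K * (n + 1 : ℝ) ^ d * P n)
    {c₁ c₂ : ℝ} (hc₁ : 0 < c₁)
    (hlower : ∀ n, ∃ y : ℝ, D n * |y - x| ≤ c₂ ∧ c₁ * P n ≤ |C (y : EReal) - C (x : EReal)|) :
    ((holderExponent C x : ℝ≥0∞) : EReal) =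
      liminf (fun n : ℕ => ((Real.log (P n) / -Real.log (D n) : ℝ) : EReal)) atTop := by
  have hl0 : 0 < l := by linarith
  have hlog : 0 < Real.log l := Real.log_pos hl
  have hD0 : ∀ n, 0 < D n := fun n => (pow_pos hl0 n).trans_le (hD n)
  have hlogD : ∀ n, n * Real.log l ≤ Real.log (D n) := fun n => by
    rw [← Real.log_pow]; exact Real.log_le_log (pow_pos hl0 n) (hD n)
  have hlogD0 : ∀ n, 0 ≤ Real.log (D n) := fun n =>
    (mul_nonneg n.cast_nonneg hlog.le).trans (hlogD n)
  have hlogDpos : ∀ n, 1 ≤ n → 0 < Real.log (D n) := fun n hn =>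
    (mul_pos (by exact_mod_cast hn) hlog).trans_le (hlogD n)
  set q : ℕ → ℝ := fun n => Real.log (P n) / -Real.log (D n) with hq
  have hq0 : ∀ n, 0 ≤ q n := fun n =>
    div_nonneg_of_nonpos (Real.log_nonpos (hP n).le (hP1 n)) (neg_nonpos.2 (hlogD0 n))
  have hexp : ∀ n α, P n * D n ^ α = Real.exp (Real.log (P n) + α * Real.log (D n)) := by
    intro n α
    rw [Real.exp_add, Real.exp_log (hP n), Real.rpow_def_of_pos (hD0 n), mul_comm α]
  have hL0 : (0 : EReal) ≤ liminf (fun n => (q n : EReal)) atTop :=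
    le_liminf_of_le (h := Eventually.of_forall fun n => by exact_mod_cast hq0 n)
  apply le_antisymm
  · by_contra! hcon
    obtain ⟨β, hβ1, hβ2⟩ := EReal.lt_iff_exists_real_btwn.1 hcon
    have hβ0 : 0 < β := by exact_mod_cast hL0.trans_lt hβ1
    have hβ3 : ENNReal.ofReal β < holderExponent C x := by
      rw [← EReal.coe_ennreal_lt_coe_ennreal_iff, EReal.coe_ennreal_ofReal, max_eq_left hβ0.le]
      exact hβ2
    obtain ⟨α, hα, hβα, B, hB⟩ := exists_of_lt_holderExponent hβ3
    rw [ENNReal.ofReal_lt_ofReal_iff hα] at hβα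
    rw [eventually_nhdsWithin_iff, Metric.eventually_nhds_iff] at hB
    obtain ⟨δ, hδ, hB⟩ := hB
    have hfreq := frequently_lt_of_liminf_lt (h := hβ1)
    have hc₂ : 0 < c₂ := by
      obtain ⟨y, hy1, hy2⟩ := hlower 0
      have hne : y ≠ x := by
        rintro rfl
        have := mul_pos hc₁ (hP 0)
        simp at hy2
        linarith
      exact (mul_pos (hD0 0) (abs_pos.2 (sub_ne_zero.2 hne))).trans_le hy1
    have ht : Tendsto (fun n : ℕ => Real.exp ((α - β) * (n * Real.log l))) atTop atTop :=
      Real.tendsto_exp_atTop.comp (Tendsto.const_mul_atTop (by linarith)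
        (tendsto_natCast_atTop_atTop.atTop_mul_const hlog))
    have ht2 : Tendsto (fun n : ℕ => l ^ n) atTop atTop := tendsto_pow_atTop_atTop_of_one_lt hl
    obtain ⟨n, hqn, hbig, hfar, hn1⟩ := (hfreq.and_eventually
      ((ht.eventually_gt_atTop (B * c₂ ^ α / c₁)).and
        ((ht2.eventually_gt_atTop (c₂ / δ)).and (eventually_ge_atTop 1)))).exists
    have hqn' : q n < β := by exact_mod_cast hqn
    obtain ⟨y, hy1, hy2⟩ := hlower n
    have hne : y ≠ x := by
      rintro rfl
      have := mul_pos hc₁ (hP n)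
      simp at hy2
      linarith
    have hpos : 0 < |y - x| := abs_pos.2 (sub_ne_zero.2 hne)
    have hnear : |y - x| < δ := by
      have h1 : c₂ < D n * δ := by
        rw [div_lt_iff₀ hδ] at hfar
        exact hfar.trans_le (mul_le_mul_of_nonneg_right (hD n) hδ.le)
      exact lt_of_mul_lt_mul_left (hy1.trans_lt h1) (hD0 n).le
    have h1 := hB (by rwa [Real.dist_eq]) hne
    rw [div_le_iff₀ (Real.rpow_pos_of_pos hpos α)] at h1
    have h2 : (D n * |y - x|) ^ α ≤ c₂ ^ α :=
      Real.rpow_le_rpow (mul_nonneg (hD0 n).le hpos.le) hy1 hα.le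
    rw [Real.mul_rpow (hD0 n).le hpos.le] at h2
    have hDα : 0 < D n ^ α := Real.rpow_pos_of_pos (hD0 n) α
    have hB0 : 0 ≤ B := by
      have h3 := (mul_pos hc₁ (hP n)).trans_le (hy2.trans h1)
      exact (pos_of_mul_pos_left h3 (Real.rpow_pos_of_pos hpos α).le).le
    have h4 : c₁ * (P n * D n ^ α) ≤ B * c₂ ^ α :=
      calc c₁ * (P n * D n ^ α) = c₁ * P n * D n ^ α := by ring
        _ ≤ B * |y - x| ^ α * D n ^ α := mul_le_mul_of_nonneg_right (hy2.trans h1) hDα.le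
        _ = B * (D n ^ α * |y - x| ^ α) := by ring
        _ ≤ _ := by gcongr
    have h5 : Real.exp ((α - β) * (n * Real.log l)) ≤ P n * D n ^ α := by
      rw [hexp]
      refine Real.exp_le_exp.2 ?_
      have h6 : -(β * Real.log (D n)) ≤ Real.log (P n) := by
        rw [hq] at hqn'
        have := (div_lt_iff_of_neg (neg_lt_zero.2 (hlogDpos n hn1))).1 hqn'
        linarith
      have h7 := mul_le_mul_of_nonneg_left (hlogD n) (by linarith : 0 ≤ α - β)
      linarith
    rw [div_lt_iff₀ hc₁] at hbig
    linarith [mul_le_mul_of_nonneg_left h5 hc₁.le]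
  · refine EReal.ge_of_forall_gt_iff_ge.1 fun α hα => ?_
    rcases le_or_gt α 0 with hα0 | hα0
    · exact le_trans (by exact_mod_cast hα0) (EReal.coe_ennreal_nonneg _)
    obtain ⟨β, hβ1, hβ2⟩ := EReal.lt_iff_exists_real_btwn.1 hα
    have hαβ : α < β := by exact_mod_cast hβ1
    have hev := eventually_lt_of_lt_liminf hβ2
    obtain ⟨N, hN⟩ := eventually_atTop.1 (hev.and (eventually_ge_atTop 1))
    set ρ : ℝ := Real.exp (-((β - α) * Real.log l)) with hρ
    have hρ0 : 0 < ρ := Real.exp_pos _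
    have hρ1 : ρ < 1 := Real.exp_lt_one_iff.2 (neg_neg_of_pos (mul_pos (by linarith) hlog))
    have htend : Tendsto (fun n : ℕ => ((n + 1 : ℕ) : ℝ) ^ d * ρ ^ (n + 1)) atTop (𝓝 0) :=
      (tendsto_pow_const_mul_const_pow_of_abs_lt_one d
        (by rwa [abs_of_pos hρ0])).comp (tendsto_add_atTop_nat 1)
    obtain ⟨M, hM⟩ := htend.bddAbove_range
    have hMn : ∀ n : ℕ, (n + 1 : ℝ) ^ d * ρ ^ n ≤ M / ρ := fun n => by
      have := hM ⟨n, rfl⟩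
      rw [le_div_iff₀ hρ0]
      push_cast at this
      rw [pow_succ] at this
      linarith
    have hfinal : ENNReal.ofReal α ≤ holderExponent C x := by
      refine le_holderExponent hα0 (B := K * (M / ρ) / c ^ α) ?_
      obtain ⟨δ, hδ, hup⟩ := hupper N
      rw [eventually_nhdsWithin_iff, Metric.eventually_nhds_iff]
      refine ⟨δ, hδ, fun y hy hyx => ?_⟩
      obtain ⟨n, hn, hcn, hCn⟩ := hup y hyx (by rwa [← Real.dist_eq])
      have hpos : 0 < |y - x| := abs_pos.2 (sub_ne_zero.2 hyx)
      obtain ⟨hqn, hn1⟩ := hN n hn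
      have hqn' : β < q n := by exact_mod_cast hqn
      have h5 : P n * D n ^ α ≤ ρ ^ n := by
        rw [hexp, hρ, ← Real.exp_nat_mul]
        refine Real.exp_le_exp.2 ?_
        have h6 : Real.log (P n) ≤ -(β * Real.log (D n)) := by
          rw [hq] at hqn'
          have := (lt_div_iff_of_neg (neg_lt_zero.2 (hlogDpos n hn1))).1 hqn'
          linarith
        have h7 := mul_le_mul_of_nonneg_left (hlogD n) (by linarith : 0 ≤ β - α)
        linarith
      have h2 : c ^ α ≤ D n ^ α * |y - x| ^ α := by
        rw [← Real.mul_rpow (hD0 n).le hpos.le]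
        exact Real.rpow_le_rpow hc.le hcn hα0.le
      have hyα : 0 < |y - x| ^ α := Real.rpow_pos_of_pos hpos α
      have hcα : 0 < c ^ α := Real.rpow_pos_of_pos hc α
      rw [div_le_iff₀ hyα, div_mul_eq_mul_div, le_div_iff₀ hcα]
      have hPn := hP n
      calc _ ≤ K * (n + 1 : ℝ) ^ d * P n * (D n ^ α * |y - x| ^ α) :=
            mul_le_mul hCn h2 hcα.le (by positivity)
        _ = K * ((n + 1 : ℝ) ^ d * (P n * D n ^ α)) * |y - x| ^ α := by ring
        _ ≤ K * ((n + 1 : ℝ) ^ d * ρ ^ n) * |y - x| ^ α := by gcongr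
        _ ≤ _ := by gcongr; exact hMn n
    have h8 := EReal.coe_ennreal_le_coe_ennreal_iff.2 hfinal
    rwa [EReal.coe_ennreal_ofReal, max_eq_left hα0.le] at h8

end HolderExponent

/-! ### Birkhoff sums of the potentials -/

section Birkhoff

variable {s : ℕ} {f : Fin (s + 1) → ℝ → ℝ} {a b η l : ℝ}

theorem birkhoffSum_psi {p : Fin s → ℝ} (hp : p ∈ paramSet s) (ω : ℕ → Fin (s + 1)) (n : ℕ) :
    birkhoffSum shift (psi p) n ω = Real.log (∏ j ∈ Finset.range n, probVec p (ω j)) := by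
  rw [Real.log_prod fun j _ => (probVec_pos hp _).ne', birkhoffSum]
  simp [psi, shift_iterate_apply]

theorem birkhoffSum_phi (h : IsSeparatedSystem f a b η l) (hderiv : ∀ i x, l ≤ deriv (f i) x)
    {Vp Vm : Set EReal} (hV : IsEscapePair f Vp Vm) {ω : ℕ → Fin (s + 1)} {x : ℝ}
    (hx : ∀ n, realOrbit f ω n x ∈ Icc a b) (n : ℕ) :
    birkhoffSum shift (phi f (Vp ∪ Vm)) n ω = -Real.log (orbitDeriv f ω n x) := by
  have hpos : ∀ i z, 0 < deriv (f i) z := fun i z => by linarith [hderiv i z, h.one_lt]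
  rw [orbitDeriv, Real.log_prod fun j _ => (hpos _ _).ne', birkhoffSum, ← Finset.sum_neg_distrib]
  refine Finset.sum_congr rfl fun k _ => ?_
  have hk : codingMap f (Vp ∪ Vm) (shift^[k] ω) = realOrbit f ω k x :=
    h.codingMap_eq hV fun m => by rw [← realOrbit_add]; exact hx _
  rw [phi, hk, shift_iterate_apply, Nat.zero_add, abs_of_pos (hpos _ _)]

theorem exists_eq_jetAt_of_isNontrivial {p : Fin s → ℝ} {C : EReal → ℝ}
    (hC : IsNontrivial f p C) : ∃ β : (Fin s → ℕ) →₀ ℝ, β ≠ 0 ∧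
      ∀ x : ℝ, C x = jetAt p β fun u => probInfty f u x := by
  obtain ⟨β, hβ, rfl⟩ := hC
  refine ⟨β, hβ, fun x => ?_⟩
  simp [Finsupp.sum, jetAt, takagiFun, Finset.sum_apply]

end Birkhoff

end GenTakagi

end

theorem corollary3p8 {s : ℕ} (hs : 1 ≤ s) (f : Fin (s + 1) → ℝ → ℝ)
    (d : EReal → EReal → ℝ) (hd : GenTakagi.IsAdmissibleMetric d)
    (hdiff : GenTakagi.IsDiffeoFamily f) (hexp : GenTakagi.IsExpanding f)
    (hfix : GenTakagi.NoCommonFixedPoint f)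
    (hcontr : GenTakagi.ContractingNearInfinity d f)
    (hsep : GenTakagi.SeparatingCondition f)
    (Vp Vm : Set EReal) (hV : GenTakagi.IsEscapePair f Vp Vm)
    (p : Fin s → ℝ) (hp : p ∈ GenTakagi.paramSet s)
    (C : EReal → ℝ) (hC : C ∈ GenTakagi.takagiSpace f p)
    (hnt : GenTakagi.IsNontrivial f p C) :
    ∀ ω : ℕ → Fin (s + 1),
      GenTakagi.fiber f (Vp ∪ Vm) ω = {((GenTakagi.codingMap f (Vp ∪ Vm) ω : ℝ) : EReal)} ∧
      ((GenTakagi.holderExponent C (GenTakagi.codingMap f (Vp ∪ Vm) ω) : ℝ≥0∞) : EReal) =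
        liminf (fun n : ℕ =>
          ((birkhoffSum GenTakagi.shift (GenTakagi.psi p) n ω /
            birkhoffSum GenTakagi.shift (GenTakagi.phi f (Vp ∪ Vm)) n ω : ℝ) : EReal)) atTop := by
  obtain ⟨a, b, η, l, h, hderiv⟩ := GenTakagi.exists_isSeparatedSystem hdiff hexp hsep
  obtain ⟨β, hβ, hCβ⟩ := GenTakagi.exists_eq_jetAt_of_isNontrivial hnt
  have hη := h.room
  have hab := h.lt
  intro ω
  obtain ⟨x, hx⟩ := h.exists_forall_realOrbit_mem ω
  have hxJ : ∀ n, GenTakagi.realOrbit f ω n x ∈ Set.Icc (a - η) (b + η) := fun n =>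
    ⟨by linarith [(hx n).1], by linarith [(hx n).2]⟩
  have hπ := h.codingMap_eq hV hx
  refine ⟨by rw [hπ]; exact h.fiber_eq hV hx, ?_⟩
  simp only [hπ, GenTakagi.birkhoffSum_psi hp, GenTakagi.birkhoffSum_phi h hderiv hV hx]
  obtain ⟨K, m, hK, hupper⟩ := h.exists_abs_increment_le hs hp β
  obtain ⟨c, hc, hexit⟩ := GenTakagi.exists_exit_time h hdiff hderiv
  obtain ⟨c₁, hc₁, hlower⟩ := h.exists_increment_ge hs hp hβ
  obtain ⟨c₃, hc₃, hdist⟩ := GenTakagi.exists_distortion h hdiff hderiv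
    (R := b - a + 2 * η) (by linarith)
  refine GenTakagi.holderExponent_eq_liminf h.one_lt
    (GenTakagi.pow_le_orbitDeriv (by linarith [h.one_lt]) hderiv ω · x)
    (fun n => Finset.prod_pos fun j _ => GenTakagi.probVec_pos hp _)
    (fun n => Finset.prod_le_one (fun j _ => (GenTakagi.probVec_pos hp _).le)
      fun j _ => (GenTakagi.probVec_lt_one hs hp _).le) hK hc (d := m) (fun N => ?_)
    (c₂ := c₃ * (b - a + 2 * η)) hc₁ fun n => ?_
  · obtain ⟨δ, hδ, hnear⟩ := hexit ω x hx N
    refine ⟨δ, hδ, fun y hyx hy => ?_⟩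
    obtain ⟨n, hn, hin, hcn⟩ := hnear y hyx hy
    refine ⟨n, hn, hcn, ?_⟩
    rw [hCβ, hCβ]
    exact hupper ω n x y (hxJ n) hin
  · obtain ⟨y, hin, hcy⟩ := hlower ω n x
    refine ⟨y, ?_, by rw [hCβ, hCβ]; exact hcy⟩
    have hR : |GenTakagi.realOrbit f ω n y - GenTakagi.realOrbit f ω n x| ≤ b - a + 2 * η :=
      (abs_sub_le_of_le_of_le hin.1 hin.2 (hxJ n).1 (hxJ n).2).trans (by linarith)
    exact ((hdist n ω x y hR).2).trans (mul_le_mul_of_nonneg_left hR hc₃.le)
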